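/- **Theorem.** Graphs are finite and may have loops and multiple edges. A signed graph $(G,\sigma)$ is a graph $G$ with a map $\sigma\colon E(G)\to\{+1,-1\}$. Each edge $e$ consists of two half-edges, one at each of its ends (both at the same vertex if $e$ is a loop); $H(v)$ denotes the set of half-edges incident with the vertex $v$, and $e_h$ the edge containing the half-edge $h$. An orientation of $(G,\sigma)$ is a map $\tau$ from the set of all half-edges to $\{+1,-1\}$ such that $\tau(h)\tau(h')=-\sigma(e)$ for each edge $e$ with half-edges $h,h'$. For an integer $k\ge 2$, a nowhere-zero $k$-flow on $(G,\sigma)$ is a pair $(\tau,f)$ of an orientation $\tau$ of $(G,\sigma)$ and a map $f\colon E(G)\to\mathbb Z$ such that $0<|f(e)|<k$ for every edge $e$ and $\sum_{h\in H(v)}\tau(h)f(e_h)=0$ for every vertex $v$. The signed graph $(G,\sigma)$ is flow-admissible if it admits a nowhere-zero $k$-flow for some integer $k\ge 2$. The graph $G$ itself admits a nowhere-zero $k$-flow if the all-positive signed graph on $G$ (the one with $\sigma\equiv +1$) does. Let $(G,\sigma)$ be a flow-admissible signed graph. If the underlying graph $G$ admits a nowhere-zero $4$-flow, then $(G,\sigma)$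 admits a nowhere-zero $8$-flow. -/

import Mathlib

open scoped Graph

namespace Graph

variable {α β : Type*}

/-- The half-edges of a multigraph: every edge `e` (loops included) consists of two half-edges,
`(e, false)` and `(e, true)`. -/
abbrev HalfEdge (G : Graph α β) : Type _ := E(G) × Bool

/-- The vertex with which a half-edge is incident. The two ends of each edge are listed in an
arbitrarily chosen order, and the half-edges `(e, false)` and `(e, true)` are attached to the first
and to the second of them. The two half-edges of a loop are attached to the same vertex. -/
noncomputable def root (G : Graph α β) (h : G.HalfEdge) : α :=
  if h.2 then (G.exists_isLink_of_mem_edgeSet h.1.2).choose_spec.choose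
  else (G.exists_isLink_of_mem_edgeSet h.1.2).choose

/-- The roots of the two half-edges of an edge are its two ends. -/
theorem isLink_root (G : Graph α β) (e : E(G)) :
    G.IsLink e.1 (G.root (e, false)) (G.root (e, true)) := by
  simpa [root] using (G.exists_isLink_of_mem_edgeSet e.2).choose_spec.choose_spec

/-- The set `H(v)` of half-edges incident with the vertex `v`. -/
noncomputable def halfEdgesAt (G : Graph α β) [Fintype E(G)] (v : α) : Finset G.HalfEdge :=
  open scoped Classical in Finset.univ.filter fun h => G.root h = v

/-- An orientation `τ` of the signed graph `(G, σ)`: a sign for every half-edge such that the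
product of the signs of the two half-edges of `e` is `-σ(e)`. The sign `1` means that the half-edge
is directed away from its vertex, `-1` that it is directed towards it. -/
def IsOrientation (G : Graph α β) (σ : E(G) → ℤˣ) (τ : G.HalfEdge → ℤˣ) : Prop :=
  ∀ e : E(G), τ (e, false) * τ (e, true) = -σ e

/-- `(τ, f)` is an `A`-flow on `(G, σ)`: `τ` is an orientation of `(G, σ)`, and at every vertex the
signed sum of the values of `f` over the incident half-edges vanishes. -/
def IsFlow (G : Graph α β) [Fintype E(G)] {A : Type*} [AddCommGroup A]
    (σ : E(G) → ℤˣ) (τ : G.HalfEdge → ℤˣ) (f : E(G) → A) : Prop :=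
  G.IsOrientation σ τ ∧ ∀ v ∈ V(G), ∑ h ∈ G.halfEdgesAt v, (τ h : ℤ) • f h.1 = 0

/-- `(τ, f)` is a (integer) `k`-flow on `(G, σ)`, where `k ≥ 2`. -/
def IsIntFlow (G : Graph α β) [Fintype E(G)]
    (σ : E(G) → ℤˣ) (τ : G.HalfEdge → ℤˣ) (f : E(G) → ℤ) (k : ℕ) : Prop :=
  2 ≤ k ∧ G.IsFlow σ τ f ∧ ∀ e, |f e| < (k : ℤ)

/-- The signed graph `(G, σ)` admits a nowhere-zero `k`-flow. -/
def AdmitsSignedNZFlow (G : Graph α β) [Fintype E(G)] (σ : E(G) → ℤˣ) (k : ℕ) : Prop :=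
  ∃ (τ : G.HalfEdge → ℤˣ) (f : E(G) → ℤ), G.IsIntFlow σ τ f k ∧ ∀ e, f e ≠ 0

/-- The (unsigned) graph `G`, which is identified with the all-positive signed graph on `G`, admits
a nowhere-zero `k`-flow. -/
def AdmitsNZFlow (G : Graph α β) [Fintype E(G)] (k : ℕ) : Prop :=
  G.AdmitsSignedNZFlow (fun _ => 1) k

/-- `(G, σ)` is flow-admissible: it admits a nowhere-zero `k`-flow for some integer `k ≥ 2`. -/
def FlowAdmissible (G : Graph α β) [Fintype E(G)] (σ : E(G) → ℤˣ) : Prop :=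
  ∃ k : ℕ, 2 ≤ k ∧ G.AdmitsSignedNZFlow σ k

end Graph

/-! Call a vector over `ZMod 2` with zero boundary a cycle, and call it odd or even according to its
number of negative edges. Components can be treated separately, so let the graph be connected. A
nowhere-zero 4-flow yields two cycles `x₁`, `x₂` that cover all edges. An even cycle is the odd part
of a signed flow with values in {0, ±1, ±2}, obtained by sending units along an Eulerian tour
(`exists_three_flow`). If both cycles are even, two such flows combine to `f + 3g`, which is nowhere
zero and below 8 in absolute value. Otherwise one may assume that `x₁` is even and `x₂` is odd. If
`x₁` contains an odd cycle, adding it to `x₂` restores the even case; if not, switching makes all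
edges of `x₁` positive.

In this last case let `C` be the support of `x₁` and contract its components. All remaining edges
lie in `x₂`, so the contracted graph is Eulerian; it has an odd number of negative edges, and
flow-admissibility prevents switching to a single negative edge. Then it has two edge-disjoint odd
cycles (`hasDisjointOddCycles`), by induction on merging two consecutive edges. The merge can only
fail when the graph is equivalent to one with three negative edges, two of them consecutive, and
there Hakimi's theorem on orientations gives the cycles. An extremal choice
(`exists_isOddPair_minimal`) improves this to a minimal odd cycle `R` whose deletion leaves only
even components, one of which still contains an odd cycle.

Orient `C` by `o` so that every vertex is balanced. Tours of the components left by `R` that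
traverse the edges of `C` once or twice and the others once give a vector `f` whose boundary, on one
component, is broken at two chosen states of the tour. The odd cycle in that component provides a
class of `C` visited with both parities. A lollipop `g` (`IsBalanced.exists_lollipop`) covers `R`,
runs along `o` inside `C` and ends in this class with whatever sign is needed, so that `3o ∓ f + 2g`
is a flow. It is nowhere zero and below 8: on `C` the part `3o + 2g` is ±3 or ±5 while `|f| ≤ 2`; on
`R` only `2g = ±2` remains; elsewhere `f` is ±1 and `|g| ≤ 1`. -/

namespace SignedFlow

/-! ### Boundaries, parities and connectivity. -/

/-- The sign `±1` of a parity. -/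
def sgn (a : ZMod 2) : ℤ := if a = 0 then 1 else -1

lemma sgn_zero : sgn 0 = 1 := by simp [sgn]

lemma sgn_add (a b : ZMod 2) : sgn (a + b) = sgn a * sgn b := by revert a b; decide

lemma sgn_mul_self (a : ZMod 2) : sgn a * sgn a = 1 := by revert a; decide

lemma sgn_cases (a : ZMod 2) : sgn a = 1 ∨ sgn a = -1 := by revert a; decide

lemma sgn_ne_zero (a : ZMod 2) : sgn a ≠ 0 := by revert a; decide

lemma sgn_cast (a : ZMod 2) : ((sgn a : ℤ) : ZMod 2) = 1 := by revert a; decide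

lemma zmod_cases (a : ZMod 2) : a = 0 ∨ a = 1 := by revert a; decide

lemma zmod_ne_zero {a : ZMod 2} : a ≠ 0 ↔ a = 1 := by revert a; decide

lemma zmod_add_eq_zero {a b : ZMod 2} : a + b = 0 ↔ a = b := by revert a b; decide

variable {V W E : Type*}

/-- Two vertices are connected by edges from `S`. -/
def conn (s t : E → V) (S : Set E) : Setoid V :=
  Relation.EqvGen.setoid fun a b => ∃ e ∈ S, s e = a ∧ t e = b

lemma conn_edge {s t : E → V} {S : Set E} {e : E} (he : e ∈ S) : conn s t S (s e) (t e) :=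
  Relation.EqvGen.rel _ _ ⟨e, he, rfl, rfl⟩

lemma conn_le {s t : E → V} {S : Set E} {T : Setoid V} (h : ∀ e ∈ S, T (s e) (t e)) :
    conn s t S ≤ T := by
  intro a b hab
  induction hab with
  | rel a b h' => obtain ⟨e, he, rfl, rfl⟩ := h'; exact h e he
  | refl a => exact T.refl a
  | symm a b _ ih => exact T.symm ih
  | trans a b c _ _ h1 h2 => exact T.trans h1 h2

lemma conn_mono {s t : E → V} {S T : Set E} (h : S ⊆ T) : conn s t S ≤ conn s t T :=
  conn_le fun _ he => conn_edge (h he)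

/-- A function that is constant along the edges of `S` is constant on the classes. -/
lemma conn_const {α : Type*} {s t : E → V} {S : Set E} {c : V → α}
    (h : ∀ e ∈ S, c (s e) = c (t e)) {a b : V} (hab : conn s t S a b) : c a = c b :=
  conn_le (T := Setoid.ker c) h hab

variable [DecidableEq V] [DecidableEq W] [Fintype E]

/-- The boundary of an integer vector on the edges of the signed multigraph in which the edge `e`
runs from `s e` to `t e` and is negative if and only if `p e = 1`. -/
def bd (s t : E → V) (p : E → ZMod 2) (f : E → ℤ) (v : V) : ℤ :=
  ∑ e, f e * ((if s e = v then 1 else 0) - sgn (p e) * (if t e = v then 1 else 0))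

/-- The boundary modulo two. -/
def bdTwo (s t : E → V) (x : E → ZMod 2) (v : V) : ZMod 2 :=
  ∑ e, x e * ((if s e = v then 1 else 0) + (if t e = v then 1 else 0))

/-- The parity of the number of negative edges. -/
def par {E : Type*} [Fintype E] (p x : E → ZMod 2) : ZMod 2 := ∑ e, x e * p e

lemma bd_add (s t : E → V) (p : E → ZMod 2) (f g : E → ℤ) (v : V) :
    bd s t p (fun e => f e + g e) v = bd s t p f v + bd s t p g v := by
  simp only [bd, ← Finset.sum_add_distrib, add_mul]

lemma bd_smul (s t : E → V) (p : E → ZMod 2) (k : ℤ) (f : E → ℤ) (v : V) :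
    bd s t p (fun e => k * f e) v = k * bd s t p f v := by
  simp only [bd, Finset.mul_sum, mul_assoc]

lemma bd_zero (s t : E → V) (p : E → ZMod 2) (v : V) : bd s t p (fun _ => 0) v = 0 := by
  simp [bd]

lemma bdTwo_add (s t : E → V) (x y : E → ZMod 2) (v : V) :
    bdTwo s t (fun e => x e + y e) v = bdTwo s t x v + bdTwo s t y v := by
  simp only [bdTwo, ← Finset.sum_add_distrib, add_mul]

lemma bdTwo_zero (s t : E → V) (v : V) : bdTwo s t (fun _ => 0) v = 0 := by
  simp [bdTwo]

lemma par_add (p x y : E → ZMod 2) : par p (fun e => x e + y e) = par p x + par p y := by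
  simp only [par, ← Finset.sum_add_distrib, add_mul]

lemma bd_cast (s t : E → V) (p : E → ZMod 2) (f : E → ℤ) (v : V) :
    ((bd s t p f v : ℤ) : ZMod 2) = bdTwo s t (fun e => (f e : ZMod 2)) v := by
  simp only [bd, bdTwo]
  push_cast
  refine Finset.sum_congr rfl fun e _ => ?_
  rw [sgn_cast, one_mul, CharTwo.sub_eq_add]

lemma bd_single [DecidableEq E] (s t : E → V) (p : E → ZMod 2) (k : ℤ) (e₀ : E) (v : V) :
    bd s t p (fun e => if e = e₀ then k else 0) v =
      k * ((if s e₀ = v then 1 else 0) - sgn (p e₀) * (if t e₀ = v then 1 else 0)) := by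
  simp [bd, ite_mul]

lemma bdTwo_single [DecidableEq E] (s t : E → V) (e₀ : E) (v : V) :
    bdTwo s t (fun e => if e = e₀ then 1 else 0) v =
      (if s e₀ = v then 1 else 0) + (if t e₀ = v then 1 else 0) := by
  simp [bdTwo, ite_mul]

lemma par_single [DecidableEq E] (p : E → ZMod 2) (e₀ : E) :
    par p (fun e => if e = e₀ then 1 else 0) = p e₀ := by
  simp [par, ite_mul]

/-- Summation by parts. Indicator weights turn this into counting across a cut, and weights `sgn ∘
c` test whether `c` is a potential for the signature. -/
lemma sum_mul_bd [Fintype V] (s t : E → V) (p : E → ZMod 2) (f : E → ℤ) (c : V → ℤ) :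
    ∑ v, c v * bd s t p f v = ∑ e, f e * (c (s e) - sgn (p e) * c (t e)) := by
  simp only [bd, Finset.mul_sum]
  rw [Finset.sum_comm]
  refine Finset.sum_congr rfl fun e _ => ?_
  have h : ∀ v, c v * (f e * ((if s e = v then 1 else 0) - sgn (p e) * (if t e = v then 1 else 0)))
      = (if s e = v then f e * c v else 0) - (if t e = v then f e * (sgn (p e) * c v) else 0) := by
    intro v; split_ifs <;> ring
  simp only [h, Finset.sum_sub_distrib, Finset.sum_ite_eq, Finset.mem_univ, if_true]
  ring

lemma sum_mul_bdTwo [Fintype V] (s t : E → V) (x : E → ZMod 2) (c : V → ZMod 2) :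
    ∑ v, c v * bdTwo s t x v = ∑ e, x e * (c (s e) + c (t e)) := by
  simp only [bdTwo, Finset.mul_sum]
  rw [Finset.sum_comm]
  refine Finset.sum_congr rfl fun e _ => ?_
  have h : ∀ v, c v * (x e * ((if s e = v then 1 else 0) + (if t e = v then 1 else 0)))
      = (if s e = v then x e * c v else 0) + (if t e = v then x e * c v else 0) := by
    intro v; split_ifs <;> ring
  simp only [h, Finset.sum_add_distrib, Finset.sum_ite_eq, Finset.mem_univ, if_true]
  ring

/-- Boundaries push forward under contraction or identification of vertices, so cycles stay cycles.
-/
lemma bdTwo_comp [Fintype V] (r : V → W) (s t : E → V) (x : E → ZMod 2) (w : W) :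
    bdTwo (r ∘ s) (r ∘ t) x w = ∑ v, (if r v = w then 1 else 0) * bdTwo s t x v := by
  rw [sum_mul_bdTwo]
  simp [bdTwo]

/-- A cycle has as many negative edges modulo two with respect to any equivalent signature. -/
lemma par_switch [Fintype V] (s t : E → V) (p x : E → ZMod 2) (hx : ∀ v, bdTwo s t x v = 0)
    (c : V → ZMod 2) : par (fun e => p e + (c (s e) + c (t e))) x = par p x := by
  have h := sum_mul_bdTwo s t x c
  simp only [hx, mul_zero, Finset.sum_const_zero] at h
  simp only [par, mul_add (x _) (p _), Finset.sum_add_distrib, ← h, add_zero]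

/-- Switching turns flows into flows. -/
lemma bd_switch (s t : E → V) (p : E → ZMod 2) (f : E → ℤ) (c : V → ZMod 2) (v : V) :
    bd s t (fun e => p e + (c (s e) + c (t e))) (fun e => sgn (c (s e)) * f e) v =
      sgn (c v) * bd s t p f v := by
  simp only [bd, Finset.mul_sum]
  refine Finset.sum_congr rfl fun e _ => ?_
  have h := sgn_mul_self (c (s e))
  simp only [sgn_add]
  split_ifs with h1 h2 h2
  · subst h1; rw [h2]; rw [h2] at *; linear_combination (-sgn (c (s e)) * sgn (p e) * f e) * h
  · subst h1; ring
  · subst h2; linear_combination (-sgn (p e) * f e * sgn (c (t e))) * h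
  · ring

/-- A path counted modulo two; concatenation is addition, and repeated edges cancel harmlessly. -/
lemma exists_bdTwo_path [DecidableEq E] {s t : E → V} {S : Set E} {a b : V}
    (hab : conn s t S a b) : ∃ x : E → ZMod 2, (∀ e, x e ≠ 0 → e ∈ S) ∧
      ∀ v, bdTwo s t x v = (if a = v then 1 else 0) + (if b = v then 1 else 0) := by
  induction hab with
  | rel a b h =>
    obtain ⟨e, he, rfl, rfl⟩ := h
    refine ⟨fun e' => if e' = e then 1 else 0, fun e' h' => ?_, fun v => bdTwo_single s t e v⟩
    by_cases h2 : e' = e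
    · exact h2 ▸ he
    · simp [h2] at h'
  | refl a => exact ⟨fun _ => 0, by simp, fun v => by rw [bdTwo_zero, CharTwo.add_self_eq_zero]⟩
  | symm a b _ ih =>
    obtain ⟨x, h1, h2⟩ := ih
    exact ⟨x, h1, fun v => by rw [h2, add_comm]⟩
  | trans a b c _ _ ih1 ih2 =>
    obtain ⟨x, h1, h2⟩ := ih1
    obtain ⟨y, h3, h4⟩ := ih2
    refine ⟨fun e => x e + y e, fun e he => ?_, fun v => ?_⟩
    · by_contra hS
      apply he
      have hx : x e = 0 := by by_contra h; exact hS (h1 e h)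
      have hy : y e = 0 := by by_contra h; exact hS (h3 e h)
      simp [hx, hy]
    · rw [bdTwo_add, h2, h4]
      have := CharTwo.add_self_eq_zero (if b = v then (1 : ZMod 2) else 0)
      linear_combination this

/-- A set of edges that contains no odd cycle has a potential. -/
lemma exists_potential [DecidableEq E] (s t : E → V) (p : E → ZMod 2) (S : Set E)
    (hS : ∀ x : E → ZMod 2, (∀ e, x e ≠ 0 → e ∈ S) → (∀ v, bdTwo s t x v = 0) → par p x = 0) :
    ∃ c : V → ZMod 2, ∀ e ∈ S, p e = c (s e) + c (t e) := by
  classical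
  let r : V → V := fun v => (Quotient.mk (conn s t S) v).out
  have hr : ∀ v, conn s t S (r v) v := fun v => Quotient.exact (Quotient.out_eq _)
  choose x hx1 hx2 using fun v => exists_bdTwo_path (hr v)
  refine ⟨fun v => par p (x v), fun e he => ?_⟩
  have hre : r (s e) = r (t e) := by
    simp only [r]
    rw [Quotient.sound (s := conn s t S) (conn_edge he)]
  -- The paths from the common representative to the two ends of `e`, closed up by `e`, form a cycle
  -- in `S`, which is even.
  have := hS (fun e' => (x (s e) e' + x (t e) e') + if e' = e then 1 else 0) ?_ ?_
  · rw [par_add, par_add, par_single, zmod_add_eq_zero] at this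
    exact this.symm
  · intro e' h'
    by_contra hS
    have h1 : x (s e) e' = 0 := by by_contra h; exact hS (hx1 _ e' h)
    have h2 : x (t e) e' = 0 := by by_contra h; exact hS (hx1 _ e' h)
    have h3 : e' ≠ e := fun h => hS (h ▸ he)
    simp [h1, h2, h3] at h'
  · intro v
    rw [bdTwo_add, bdTwo_add, bdTwo_single, hx2, hx2, hre]
    have h1 := CharTwo.add_self_eq_zero (if r (t e) = v then (1 : ZMod 2) else 0)
    have h2 := CharTwo.add_self_eq_zero (if s e = v then (1 : ZMod 2) else 0)
    have h3 := CharTwo.add_self_eq_zero (if t e = v then (1 : ZMod 2) else 0)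
    linear_combination h1 + h2 + h3

/-- A vector modulo two whose sum on every class vanishes is a boundary. -/
lemma exists_bdTwo_eq [Fintype V] [DecidableEq E] (s t : E → V) (S : Set E) (T : V → ZMod 2)
    (r : V → V) (hr : ∀ v, conn s t S (r v) v) (hT : ∀ w, ∑ v, (if r v = w then T v else 0) = 0) :
    ∃ x : E → ZMod 2, (∀ e, x e ≠ 0 → e ∈ S) ∧ ∀ v, bdTwo s t x v = T v := by
  choose x hx1 hx2 using fun v => exists_bdTwo_path (hr v)
  -- Superpose the paths from each `v` with `T v = 1` to its representative; at the representatives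
  -- the contributions cancel by `hT`.
  refine ⟨fun e => ∑ v, T v * x v e, fun e he => ?_, fun w => ?_⟩
  · obtain ⟨v, _, hv⟩ := Finset.exists_ne_zero_of_sum_ne_zero he
    exact hx1 v e (right_ne_zero_of_mul hv)
  · have : bdTwo s t (fun e => ∑ v, T v * x v e) w = ∑ v, T v * bdTwo s t (x v) w := by
      simp only [bdTwo, Finset.sum_mul, Finset.mul_sum]
      rw [Finset.sum_comm]
      simp only [mul_assoc]
    rw [this]
    simp only [hx2, mul_add, Finset.sum_add_distrib, mul_ite, mul_one, mul_zero, hT, zero_add]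
    simp

end SignedFlow

/-! ### Signed walks and Eulerian tours. -/

namespace SignedFlow

variable {V E : Type*}

/-- The initial vertex of a dart, that is, of an edge together with a direction. -/
def dartTail (s t : E → V) (d : E × Bool) : V := if d.2 then t d.1 else s d.1

/-- The terminal vertex of a dart. -/
def dartHead (s t : E → V) (d : E × Bool) : V := if d.2 then s d.1 else t d.1

/-- The list of darts `l` is a walk from `u` to `w`. -/
def IsWalk (s t : E → V) : V → List (E × Bool) → V → Prop
  | u, [], w => u = w
  | u, d :: l, w => dartTail s t d = u ∧ IsWalk s t (dartHead s t d) l w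

/-- The parity of the number of negative edges of a walk. -/
def walkPar (p : E → ZMod 2) (l : List (E × Bool)) : ZMod 2 := (l.map fun d => p d.1).sum

/-- The number of times that a walk traverses an edge. -/
def walkCount [DecidableEq E] (l : List (E × Bool)) (e : E) : ℕ := (l.map Prod.fst).count e

/-- The integer vector obtained by sending a unit of sign `sgn a` along a walk. -/
def walkVec [DecidableEq E] (p : E → ZMod 2) : ZMod 2 → List (E × Bool) → E → ℤ
  | _, [], _ => 0
  | a, d :: l, e =>
    (if e = d.1 then (if d.2 then -sgn (a + p d.1) else sgn a) else 0)
      + walkVec p (a + p d.1) l e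

lemma isWalk_append {s t : E → V} {l₁ l₂ : List (E × Bool)} {u w : V} :
    IsWalk s t u (l₁ ++ l₂) w ↔ ∃ v, IsWalk s t u l₁ v ∧ IsWalk s t v l₂ w := by
  induction l₁ generalizing u with
  | nil => simp [IsWalk]
  | cons d l ih => simp [IsWalk, ih, and_assoc]

lemma IsWalk.unique {s t : E → V} {l : List (E × Bool)} {z x y : V} (h₁ : IsWalk s t z l x)
    (h₂ : IsWalk s t z l y) : x = y := by
  induction l generalizing z with
  | nil => exact h₁.symm.trans h₂
  | cons d l ih => exact ih h₁.2 h₂.2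

lemma walkPar_append (p : E → ZMod 2) (l₁ l₂ : List (E × Bool)) :
    walkPar p (l₁ ++ l₂) = walkPar p l₁ + walkPar p l₂ := by
  simp [walkPar]

lemma walkPar_cons (p : E → ZMod 2) (d : E × Bool) (l : List (E × Bool)) :
    walkPar p (d :: l) = p d.1 + walkPar p l := by
  simp [walkPar]

lemma conn_of_isWalk {s t : E → V} {S : Set E} {l : List (E × Bool)} {u w : V}
    (h : IsWalk s t u l w) (hl : ∀ d ∈ l, d.1 ∈ S) : conn s t S u w := by
  induction l generalizing u with
  | nil => exact h ▸ (conn s t S).refl u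
  | cons d l ih =>
    obtain ⟨h1, h2⟩ := h
    have h3 := ih h2 fun d' hd' => hl d' (List.mem_cons_of_mem _ hd')
    have h4 : conn s t S (s d.1) (t d.1) := conn_edge (hl d List.mem_cons_self)
    refine (conn s t S).trans ?_ h3
    rw [← h1]
    unfold dartTail dartHead
    split_ifs
    · exact (conn s t S).symm h4
    · exact h4

section Count

variable [DecidableEq E]

lemma walkCount_append (l₁ l₂ : List (E × Bool)) (e : E) :
    walkCount (l₁ ++ l₂) e = walkCount l₁ e + walkCount l₂ e := by
  simp [walkCount]

lemma walkCount_cons (d : E × Bool) (l : List (E × Bool)) (e : E) :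
    walkCount (d :: l) e = walkCount l e + if e = d.1 then 1 else 0 := by
  simp only [walkCount, List.map_cons, List.count_cons, beq_iff_eq, eq_comm (a := e)]

lemma walkCount_pos {l : List (E × Bool)} {e : E} :
    0 < walkCount l e ↔ ∃ d ∈ l, d.1 = e := by
  simp [walkCount, List.count_pos_iff]

lemma abs_walkVec_le (p : E → ZMod 2) (a : ZMod 2) (l : List (E × Bool)) (e : E) :
    |walkVec p a l e| ≤ walkCount l e := by
  induction l generalizing a with
  | nil => simp [walkVec]
  | cons d l ih =>
    rw [walkVec, walkCount_cons]
    refine (abs_add_le _ _).trans ?_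
    have h1 := ih (a + p d.1)
    have h2 := sgn_cases (a + p d.1)
    have h3 := sgn_cases a
    push_cast
    split_ifs <;> rcases h2 with h2 | h2 <;> rcases h3 with h3 | h3 <;> simp [h2, h3] <;> linarith

lemma walkVec_cast (p : E → ZMod 2) (a : ZMod 2) (l : List (E × Bool)) (e : E) :
    ((walkVec p a l e : ℤ) : ZMod 2) = walkCount l e := by
  induction l generalizing a with
  | nil => simp [walkVec, walkCount]
  | cons d l ih =>
    rw [walkVec, walkCount_cons]
    push_cast
    rw [ih, add_comm]
    congr 1
    split_ifs <;> simp [sgn_cast]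

lemma bd_walkVec [DecidableEq V] [Fintype E] {s t : E → V} (p : E → ZMod 2) (a : ZMod 2)
    {l : List (E × Bool)} {u w : V} (h : IsWalk s t u l w) (v : V) :
    bd s t p (walkVec p a l) v =
      sgn a * (if u = v then 1 else 0) - sgn (a + walkPar p l) * (if w = v then 1 else 0) := by
  induction l generalizing u a with
  | nil =>
    have h' : u = w := h
    subst h'
    have : walkVec p a [] = fun _ : E => (0 : ℤ) := by ext; rfl
    rw [this, bd_zero]
    simp [walkPar]
  | cons d l ih =>
    obtain ⟨h1, h2⟩ := h
    have : walkVec p a (d :: l) = fun e =>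
      (if e = d.1 then (if d.2 then -sgn (a + p d.1) else sgn a) else 0)
        + walkVec p (a + p d.1) l e := by ext; rfl
    rw [this, bd_add, bd_single, ih _ h2, walkPar_cons, ← add_assoc, ← h1]
    have h := sgn_mul_self (p d.1)
    unfold dartTail dartHead
    rw [sgn_add a]
    cases d.2
    · simp only [Bool.false_eq_true, if_false]
      ring
    · simp only [if_true]
      linear_combination (sgn a * if t d.1 = v then 1 else 0) * h

lemma bdTwo_walkCount [DecidableEq V] [Fintype E] {s t : E → V}
    {l : List (E × Bool)} {u w : V} (h : IsWalk s t u l w) (v : V) :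
    bdTwo s t (fun e => (walkCount l e : ZMod 2)) v =
      (if u = v then 1 else 0) + (if w = v then 1 else 0) := by
  have := bd_cast s t (fun _ => 0) (walkVec (fun _ => 0) 0 l) v
  simp only [walkVec_cast] at this
  rw [← this, bd_walkVec _ _ h]
  push_cast
  rw [sgn_cast, sgn_cast, CharTwo.sub_eq_add, one_mul, one_mul]

lemma walkPar_eq_sum [Fintype E] (p : E → ZMod 2) (l : List (E × Bool)) :
    walkPar p l = ∑ e, (walkCount l e : ZMod 2) * p e := by
  induction l with
  | nil => simp [walkPar, walkCount]
  | cons d l ih =>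
    rw [walkPar_cons, ih]
    simp [walkCount_cons, add_mul, Finset.sum_add_distrib, ite_mul, add_comm]

lemma length_eq_sum_walkCount [Fintype E] (l : List (E × Bool)) :
    l.length = ∑ e, walkCount l e := by
  induction l with
  | nil => simp [walkCount]
  | cons d l ih => simp [walkCount_cons, Finset.sum_add_distrib, ← ih]

end Count

section Tour

variable [DecidableEq V] [Fintype E] [DecidableEq E] {s t : E → V} {m : E → ℕ}

/-- In a multigraph with even degrees, a walk that is not closed can be prolonged. -/
lemma exists_dart_of_ne (hm : ∀ v, bdTwo s t (fun e => (m e : ZMod 2)) v = 0)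
    {l : List (E × Bool)} {u w : V} (h : IsWalk s t u l w) (hl : ∀ e, walkCount l e ≤ m e)
    (huw : u ≠ w) : ∃ d : E × Bool, dartTail s t d = w ∧ walkCount l d.1 < m d.1 := by
  by_contra! hcon
  have h1 := bdTwo_walkCount h w
  rw [if_neg huw, if_pos rfl, zero_add] at h1
  have h2 : bdTwo s t (fun e => (walkCount l e : ZMod 2)) w =
      bdTwo s t (fun e => (m e : ZMod 2)) w := by
    refine Finset.sum_congr rfl fun e _ => ?_
    show (walkCount l e : ZMod 2) * _ = (m e : ZMod 2) * _
    by_cases hs : s e = w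
    · rw [le_antisymm (hl e) (hcon (e, false) (by simp [dartTail, hs]))]
    by_cases ht : t e = w
    · rw [le_antisymm (hl e) (hcon (e, true) (by simp [dartTail, ht]))]
    simp [hs, ht]
  rw [h2, hm w] at h1
  exact zero_ne_one h1

/-- Every edge of a multigraph with even degrees lies on a closed trail. -/
lemma exists_closed_walk (hm : ∀ v, bdTwo s t (fun e => (m e : ZMod 2)) v = 0)
    (d : E × Bool) (hd : 0 < m d.1) : ∃ l : List (E × Bool), l ≠ [] ∧
      IsWalk s t (dartTail s t d) l (dartTail s t d) ∧ ∀ e, walkCount l e ≤ m e := by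
  by_contra! hcon
  have key : ∀ n : ℕ, ∃ l : List (E × Bool), l.length = n + 1 ∧
      (∃ w, IsWalk s t (dartTail s t d) l w) ∧ ∀ e, walkCount l e ≤ m e := by
    intro n
    induction n with
    | zero =>
      refine ⟨[d], rfl, ⟨dartHead s t d, by simp [IsWalk]⟩, fun e => ?_⟩
      rw [walkCount_cons]
      split_ifs with h
      · subst h; simpa [walkCount] using Nat.succ_le_of_lt hd
      · simp [walkCount]
    | succ n ih =>
      obtain ⟨l, h1, ⟨w, h2⟩, h3⟩ := ih
      have hw : dartTail s t d ≠ w := by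
        rintro rfl
        obtain ⟨e, he⟩ := hcon l (by rintro rfl; simp at h1) h2
        exact absurd (h3 e) (not_le.2 he)
      obtain ⟨d', h4, h5⟩ := exists_dart_of_ne hm h2 h3 hw
      refine ⟨l ++ [d'], by simp [h1], ⟨dartHead s t d', ?_⟩, fun e => ?_⟩
      · exact isWalk_append.2 ⟨w, h2, by simp [IsWalk, h4]⟩
      · rw [walkCount_append, walkCount_cons]
        split_ifs with h
        · subst h; simpa [walkCount] using h5
        · simpa [walkCount] using h3 e
  obtain ⟨l, h1, -, h3⟩ := key (∑ e, m e)
  have := Finset.sum_le_sum fun e (_ : e ∈ Finset.univ) => h3 e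
  rw [← length_eq_sum_walkCount, h1] at this
  omega

/-- A state of a walk from `z` along `l`: it visits `v` after an initial part of parity `a`. -/
def WalkState (s t : E → V) (p : E → ZMod 2) (z : V) (l : List (E × Bool)) (v : V) (a : ZMod 2) :
    Prop :=
  ∃ l₁ l₂, l = l₁ ++ l₂ ∧ IsWalk s t z l₁ v ∧ walkPar p l₁ = a

omit [DecidableEq V] [Fintype E] [DecidableEq E] in
lemma walkState_of_mem {p : E → ZMod 2} {z w : V} {l : List (E × Bool)}
    (h : IsWalk s t z l w) {d : E × Bool} (hd : d ∈ l) :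
    ∃ a, WalkState s t p z l (s d.1) a ∧ WalkState s t p z l (t d.1) (a + p d.1) := by
  obtain ⟨l₁, l₂, rfl⟩ := List.append_of_mem hd
  obtain ⟨v, h1, h2, h3⟩ := isWalk_append.1 h
  have hv : WalkState s t p z (l₁ ++ d :: l₂) (dartTail s t d) (walkPar p l₁) :=
    ⟨l₁, d :: l₂, rfl, h2 ▸ h1, rfl⟩
  have hw : WalkState s t p z (l₁ ++ d :: l₂) (dartHead s t d) (walkPar p l₁ + p d.1) :=
    ⟨l₁ ++ [d], l₂, by simp, isWalk_append.2 ⟨v, h1, h2, rfl⟩, by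
      rw [walkPar_append]; simp [walkPar]⟩
  unfold dartTail dartHead at *
  cases hb : d.2
  · simp only [hb, Bool.false_eq_true, if_false] at hv hw
    exact ⟨_, hv, hw⟩
  · simp only [hb, if_true] at hv hw
    refine ⟨_, hw, ?_⟩
    rwa [add_assoc, CharTwo.add_self_eq_zero, add_zero]

/-- In a multigraph with even degrees there is a closed walk from `z` that traverses every edge
of the component of `z` as often as its multiplicity tells. -/
lemma exists_eulerian_walk (hm : ∀ v, bdTwo s t (fun e => (m e : ZMod 2)) v = 0) (z : V) :
    ∃ l : List (E × Bool), IsWalk s t z l z ∧ (∀ e, walkCount l e ≤ m e) ∧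
      ∀ e, conn s t {e | m e ≠ 0} z (s e) → walkCount l e = m e := by
  by_contra! hcon
  have key : ∀ n : ℕ, ∃ l : List (E × Bool), n ≤ l.length ∧
      IsWalk s t z l z ∧ ∀ e, walkCount l e ≤ m e := by
    intro n
    induction n with
    | zero => exact ⟨[], le_rfl, rfl, fun e => by simp [walkCount]⟩
    | succ n ih =>
      obtain ⟨l, h1, h2, h3⟩ := ih
      obtain ⟨e₀, h4, h5⟩ := hcon l h2 h3
      let vis : V → Prop := fun v => ∃ a, WalkState s t (fun _ => 0) z l v a
      have hmem : ∀ e, 0 < walkCount l e → vis (s e) ∧ vis (t e) := by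
        intro e he
        obtain ⟨d, hd, rfl⟩ := walkCount_pos.1 he
        obtain ⟨a, ha, hb⟩ := walkState_of_mem h2 hd
        exact ⟨⟨_, ha⟩, ⟨_, hb⟩⟩
      have hz : vis z := ⟨0, [], l, rfl, rfl, rfl⟩
      -- If every edge at a visited vertex were exhausted, the visited set would be closed under
      -- adjacency and contain `s e₀`. The residual multiplicities still have even degrees, so a
      -- closed walk through `d` can be spliced in.
      obtain ⟨d, hd1, hd2⟩ : ∃ d : E × Bool, vis (dartTail s t d) ∧ walkCount l d.1 < m d.1 := by
        by_contra! hno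
        have hs : ¬ vis (s e₀) := fun h =>
          h5 (le_antisymm (h3 e₀) (hno (e₀, false) h))
        have : vis z = vis (s e₀) := by
          refine conn_const (c := vis) (fun e he => propext ⟨fun h => ?_, fun h => ?_⟩) h4
          · exact (hmem e ((Nat.pos_of_ne_zero he).trans_le (hno (e, false) h))).2
          · exact (hmem e ((Nat.pos_of_ne_zero he).trans_le (hno (e, true) h))).1
        exact hs (this ▸ hz)
      have hres : ∀ v, bdTwo s t (fun e => ((m e - walkCount l e : ℕ) : ZMod 2)) v = 0 := by
        intro v
        have h6 := bdTwo_walkCount h2 v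
        rw [CharTwo.add_self_eq_zero] at h6
        have h7 := bdTwo_add s t (fun e => ((m e - walkCount l e : ℕ) : ZMod 2))
          (fun e => (walkCount l e : ZMod 2)) v
        rw [h6, add_zero] at h7
        rw [← h7, ← hm v]
        congr 1
        ext e
        rw [← Nat.cast_add, Nat.sub_add_cancel (h3 e)]
      obtain ⟨c, hc1, hc2, hc3⟩ := exists_closed_walk hres d (Nat.sub_pos_of_lt hd2)
      obtain ⟨-, l₁, l₂, rfl, hl1, -⟩ := hd1
      obtain ⟨v, h8, h9⟩ := isWalk_append.1 h2
      obtain rfl := IsWalk.unique hl1 h8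
      refine ⟨l₁ ++ (c ++ l₂), ?_, ?_, fun e => ?_⟩
      · have := List.length_pos_iff.2 hc1
        simp only [List.length_append] at h1 ⊢
        omega
      · exact isWalk_append.2 ⟨_, hl1, isWalk_append.2 ⟨_, hc2, h9⟩⟩
      · have h10 := hc3 e
        have h11 := h3 e
        simp only [walkCount_append] at h10 h11 ⊢
        omega
  obtain ⟨l, h1, -, h3⟩ := key (∑ e, m e + 1)
  have := Finset.sum_le_sum fun e (_ : e ∈ Finset.univ) => h3 e
  rw [← length_eq_sum_walkCount] at this
  omega

/-- Reversing the sign of a closed walk at two of its states. -/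
lemma exists_bd_of_split {p : E → ZMod 2} {z u w : V} {A K C : List (E × Bool)}
    (hA : IsWalk s t z A u) (hK : IsWalk s t u K w) (hC : IsWalk s t w C z)
    (hpar : walkPar p A + walkPar p K + walkPar p C = 0) (c : ZMod 2) :
    ∃ g : E → ℤ, (∀ e, |g e| ≤ walkCount (A ++ K ++ C) e) ∧
      (∀ e, (g e : ZMod 2) = walkCount (A ++ K ++ C) e) ∧
      ∀ v, bd s t p g v = -2 * sgn (c + walkPar p A) * (if u = v then 1 else 0)
        + 2 * sgn (c + (walkPar p A + walkPar p K)) * (if w = v then 1 else 0) := by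
  -- The summand 1 reverses the sign along the middle piece `K`, so the units at its two ends add to
  -- ±2 instead of cancelling; at `z` they cancel since the closed walk is even.
  refine ⟨fun e => (walkVec p c A e + walkVec p (c + walkPar p A + 1) K e)
    + walkVec p (c + (walkPar p A + walkPar p K)) C e, fun e => ?_, fun e => ?_, fun v => ?_⟩
  · have h1 := abs_walkVec_le p c A e
    have h2 := abs_walkVec_le p (c + walkPar p A + 1) K e
    have h3 := abs_walkVec_le p (c + (walkPar p A + walkPar p K)) C e
    rw [walkCount_append, walkCount_append]
    push_cast
    exact (abs_add_le _ _).trans (add_le_add ((abs_add_le _ _).trans (add_le_add h1 h2)) h3)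
  · push_cast
    rw [walkVec_cast, walkVec_cast, walkVec_cast, walkCount_append, walkCount_append]
    push_cast
    rfl
  · rw [bd_add, bd_add, bd_walkVec _ _ hA, bd_walkVec _ _ hK, bd_walkVec _ _ hC, add_assoc c _ (walkPar p C), hpar,
      add_zero]
    have h1 : sgn (c + walkPar p A + 1) = -sgn (c + walkPar p A) := by
      rw [sgn_add _ 1]; simp [sgn]
    have h2 : sgn (c + walkPar p A + 1 + walkPar p K) = -sgn (c + (walkPar p A + walkPar p K)) := by
      rw [show c + walkPar p A + 1 + walkPar p K = c + (walkPar p A + walkPar p K) + 1 by ring,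
        sgn_add _ 1]
      simp [sgn]
    rw [h1, h2]
    ring

lemma exists_bd_of_walkState {p : E → ZMod 2} {z u w : V} {l : List (E × Bool)}
    (h : IsWalk s t z l z) (hpar : walkPar p l = 0) {a b : ZMod 2}
    (hu : WalkState s t p z l u a) (hw : WalkState s t p z l w b) :
    ∃ g : E → ℤ, (∀ e, |g e| ≤ walkCount l e) ∧ (∀ e, (g e : ZMod 2) = walkCount l e) ∧
      ∀ v, bd s t p g v = 2 * (sgn a * (if u = v then 1 else 0)
        - sgn b * (if w = v then 1 else 0)) := by
  obtain ⟨l₁, l₂, rfl, h1, rfl⟩ := hu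
  obtain ⟨k₁, k₂, h2, h3, rfl⟩ := hw
  -- Both states are initial segments of one list, so one precedes the other. The starting parity, 1
  -- or 0, corrects the overall sign according to which comes first.
  rcases List.append_eq_append_iff.1 h2 with ⟨K, rfl, rfl⟩ | ⟨K, rfl, rfl⟩
  · obtain ⟨x, h4, h5⟩ := isWalk_append.1 h3
    obtain rfl := IsWalk.unique h1 h4
    rw [← List.append_assoc] at h hpar ⊢
    obtain ⟨y, h6, h7⟩ := isWalk_append.1 h
    obtain rfl := IsWalk.unique h3 h6
    rw [walkPar_append, walkPar_append] at hpar
    obtain ⟨g, hg1, hg2, hg3⟩ := exists_bd_of_split h1 h5 h7 hpar 1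
    refine ⟨g, hg1, hg2, fun v => ?_⟩
    rw [hg3, walkPar_append, sgn_add 1, sgn_add 1]
    simp only [sgn, one_ne_zero, if_false]
    ring
  · obtain ⟨x, h4, h5⟩ := isWalk_append.1 h1
    obtain rfl := IsWalk.unique h3 h4
    obtain ⟨y, h6, h7⟩ := isWalk_append.1 h
    obtain rfl := IsWalk.unique h1 h6
    rw [walkPar_append, walkPar_append] at hpar
    obtain ⟨g, hg1, hg2, hg3⟩ := exists_bd_of_split h3 h5 h7 hpar 0
    refine ⟨g, hg1, hg2, fun v => ?_⟩
    rw [hg3, walkPar_append, zero_add, zero_add]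
    ring

/-- The tour lemma: the component of `z` in a multigraph with even degrees has a set `T` of states
(the visits of an Eulerian walk) such that, if the number of its negative edges is even, then the
difference of any two states, doubled, is the boundary of a vector that is congruent to the
multiplicities and bounded by them. -/
theorem exists_tour (p : E → ZMod 2) (hm : ∀ v, bdTwo s t (fun e => (m e : ZMod 2)) v = 0)
    (z : V) : ∃ T : V → ZMod 2 → Prop,
      (∀ v, conn s t {e | m e ≠ 0} z v → ∃ a, T v a) ∧
      (∀ e, m e ≠ 0 → conn s t {e | m e ≠ 0} z (s e) → ∃ a, T (s e) a ∧ T (t e) (a + p e)) ∧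
      ((∀ x : E → ZMod 2, (∀ e, conn s t {e | m e ≠ 0} z (s e) → x e = m e) →
          (∀ e, ¬ conn s t {e | m e ≠ 0} z (s e) → x e = 0) → par p x = 0) →
        ∀ u a w b, T u a → T w b → ∃ g : E → ℤ,
          (∀ e, conn s t {e | m e ≠ 0} z (s e) → |g e| ≤ m e ∧ (g e : ZMod 2) = m e) ∧
          (∀ e, ¬ conn s t {e | m e ≠ 0} z (s e) → g e = 0) ∧
          ∀ v, bd s t p g v = 2 * (sgn a * (if u = v then 1 else 0)
            - sgn b * (if w = v then 1 else 0))) := by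
  obtain ⟨l, h1, h2, h3⟩ := exists_eulerian_walk hm z
  have hsupp : ∀ d ∈ l, d.1 ∈ {e | m e ≠ 0} := fun d hd =>
    ((walkCount_pos.2 ⟨d, hd, rfl⟩).trans_le (h2 d.1)).ne'
  have hedge : ∀ e, m e ≠ 0 → conn s t {e | m e ≠ 0} z (s e) →
      ∃ a, WalkState s t p z l (s e) a ∧ WalkState s t p z l (t e) (a + p e) := by
    intro e he hz
    obtain ⟨d, hd, rfl⟩ := walkCount_pos.1 ((Nat.pos_of_ne_zero he).trans_eq (h3 e hz).symm)
    exact walkState_of_mem h1 hd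
  have hvis : ∀ v, (∃ a, WalkState s t p z l v a) → conn s t {e | m e ≠ 0} z v := by
    rintro v ⟨a, l₁, l₂, rfl, hl, -⟩
    exact conn_of_isWalk hl fun d hd => hsupp d (List.mem_append_left _ hd)
  have hzero : ∀ e, ¬ conn s t {e | m e ≠ 0} z (s e) → walkCount l e = 0 := by
    intro e he
    by_contra h
    obtain ⟨d, hd, rfl⟩ := walkCount_pos.1 (Nat.pos_of_ne_zero h)
    obtain ⟨a, ha, -⟩ := walkState_of_mem (p := p) h1 hd
    exact he (hvis _ ⟨a, ha⟩)
  refine ⟨WalkState s t p z l, fun v hv => ?_, hedge, fun hpar u a w b hu hw => ?_⟩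
  · have : (∃ a, WalkState s t p z l z a) = (∃ a, WalkState s t p z l v a) := by
      refine conn_const (c := fun v => ∃ a, WalkState s t p z l v a)
        (fun e he => propext ⟨fun h => ?_, fun h => ?_⟩) hv
      · obtain ⟨a, -, ha⟩ := hedge e he (hvis _ h)
        exact ⟨_, ha⟩
      · obtain ⟨a, ha, -⟩ := hedge e he
          ((conn s t _).trans (hvis _ h) ((conn s t _).symm (conn_edge he)))
        exact ⟨_, ha⟩
    exact this ▸ ⟨0, [], l, rfl, rfl, rfl⟩
  · have hl : walkPar p l = 0 := by
      rw [walkPar_eq_sum]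
      exact hpar (fun e => walkCount l e) (fun e he => by rw [h3 e he])
        (fun e he => by rw [hzero e he]; simp)
    obtain ⟨g, hg1, hg2, hg3⟩ := exists_bd_of_walkState h1 hl hu hw
    refine ⟨g, fun e he => ?_, fun e he => ?_, hg3⟩
    · rw [← h3 e he]; exact ⟨hg1 e, hg2 e⟩
    · have := hg1 e
      rw [hzero e he] at this
      simpa using this

end Tour

end SignedFlow

/-! ### Flows supported on cycles, and the even case. -/

namespace SignedFlow

variable {V E : Type*} [DecidableEq V] [Fintype E]

/-- Vectors that live on different components can be glued. -/
lemma bd_glue {ι : Type*} {s t : E → V} (p : E → ZMod 2) (κ : V → ι) (g : ι → E → ℤ)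
    (hg : ∀ i e, κ (s e) ≠ i → g i e = 0) (hκ : ∀ e, g (κ (s e)) e ≠ 0 → κ (t e) = κ (s e)) (v : V) :
    bd s t p (fun e => g (κ (s e)) e) v = bd s t p (g (κ v)) v := by
  refine Finset.sum_congr rfl fun e _ => ?_
  show g (κ (s e)) e * _ = g (κ v) e * _
  by_cases hs : s e = v
  · rw [hs]
  by_cases ht : t e = v
  · by_cases h : κ (s e) = κ v
    · rw [h]
    · have h1 : g (κ (s e)) e = 0 := by
        by_contra h2
        exact h (by rw [← hκ e h2, ht])
      rw [h1, hg _ _ h]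
  · simp [hs, ht]

variable [DecidableEq E] {s t : E → V}

/-- If every component has an even number of negative edges, then the multiplicities are the
absolute values modulo two of a flow that they bound. -/
theorem exists_flow_of_even (p : E → ZMod 2) {m : E → ℕ}
    (hm : ∀ v, bdTwo s t (fun e => (m e : ZMod 2)) v = 0)
    (hpar : ∀ z, ∀ x : E → ZMod 2, (∀ e, conn s t {e | m e ≠ 0} z (s e) → x e = m e) →
      (∀ e, ¬ conn s t {e | m e ≠ 0} z (s e) → x e = 0) → par p x = 0) :
    ∃ g : E → ℤ, (∀ e, |g e| ≤ m e ∧ (g e : ZMod 2) = m e) ∧ ∀ v, bd s t p g v = 0 := by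
  have key : ∀ z, ∃ g : E → ℤ, (∀ e, conn s t {e | m e ≠ 0} z (s e) →
      |g e| ≤ m e ∧ (g e : ZMod 2) = m e) ∧
      (∀ e, ¬ conn s t {e | m e ≠ 0} z (s e) → g e = 0) ∧ ∀ v, bd s t p g v = 0 := by
    intro z
    obtain ⟨T, h1, -, h3⟩ := exists_tour p hm z
    obtain ⟨a, ha⟩ := h1 z ((conn s t _).refl z)
    obtain ⟨g, hg1, hg2, hg3⟩ := h3 (hpar z) z a z a ha ha
    exact ⟨g, hg1, hg2, fun v => by rw [hg3]; ring⟩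
  choose g hg1 hg2 hg3 using key
  let κ : V → Quotient (conn s t {e | m e ≠ 0}) := Quotient.mk _
  have hκ : ∀ (i : Quotient (conn s t {e | m e ≠ 0})) v, conn s t {e | m e ≠ 0} i.out v ↔ κ v = i := by
    intro i v
    rw [eq_comm, ← Quotient.out_eq i]
    exact ⟨fun h => Quotient.sound (by simpa using h), fun h => by simpa using Quotient.exact h⟩
  refine ⟨fun e => g (κ (s e)).out e, fun e => hg1 _ e ((hκ _ _).2 rfl), fun v => ?_⟩
  rw [bd_glue p κ (fun i => g i.out), hg3]
  · intro i e h
    exact hg2 _ _ fun h' => h ((hκ _ _).1 h')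
  · intro e h
    have h1 := hg1 (κ (s e)).out e ((hκ _ _).2 rfl)
    have h2 : m e ≠ 0 := by
      intro h0
      rw [h0] at h1
      exact h (by simpa using h1.1)
    exact (Quotient.sound (conn_edge h2)).symm

/-- With no negative edges in the support, the parity condition holds on each component;
multiplicity 1 on the support and 0 elsewhere forces the values. -/
lemma exists_flow_of_pos (p : E → ZMod 2) {x : E → ZMod 2} (hx : ∀ v, bdTwo s t x v = 0)
    (hp : ∀ e, x e ≠ 0 → p e = 0) :
    ∃ g : E → ℤ, (∀ e, x e ≠ 0 → g e = 1 ∨ g e = -1) ∧ (∀ e, x e = 0 → g e = 0) ∧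
      ∀ v, bd s t p g v = 0 := by
  have hcast : ∀ e, ((if x e = 0 then 0 else 1 : ℕ) : ZMod 2) = x e := by
    intro e
    rcases zmod_cases (x e) with h | h <;> simp [h]
  obtain ⟨g, hg1, hg2⟩ := exists_flow_of_even (s := s) (t := t) p (m := fun e => if x e = 0 then 0 else 1)
    (fun v => by simpa only [hcast] using hx v) (fun z y h1 h2 => by
      refine Finset.sum_eq_zero fun e _ => ?_
      by_cases he : conn s t {e | (if x e = 0 then 0 else 1) ≠ 0} z (s e)
      · rw [h1 e he, hcast]
        by_cases hxe : x e = 0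
        · simp [hxe]
        · simp [hp e hxe]
      · simp [h2 e he])
  refine ⟨g, fun e he => ?_, fun e he => ?_, hg2⟩
  · have h := hg1 e
    rw [if_neg he] at h
    have h0 : g e ≠ 0 := by
      intro h0
      simp [h0] at h
    have h3 := abs_le.1 h.1
    push_cast at h3
    omega
  · have h := (hg1 e).1
    rw [if_pos he] at h
    simpa using h

/-- In a connected signed multigraph every cycle with an even number of negative edges is the set
of odd values of a `3`-flow. -/
lemma exists_three_flow {p x : E → ZMod 2} (hconn : ∀ a b, conn s t Set.univ a b)
    (hx : ∀ v, bdTwo s t x v = 0) (hpar : par p x = 0) :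
    ∃ g : E → ℤ, (∀ e, x e ≠ 0 → g e = 1 ∨ g e = -1) ∧
      (∀ e, x e = 0 → g e = 0 ∨ g e = 2 ∨ g e = -2) ∧ ∀ v, bd s t p g v = 0 := by
  have hcast : ∀ e, ((if x e = 0 then 2 else 1 : ℕ) : ZMod 2) = x e := by
    intro e
    rcases zmod_cases (x e) with h | h <;> simp [h]
    rfl
  have hS : {e | (if x e = 0 then 2 else 1 : ℕ) ≠ 0} = Set.univ := by
    ext e; by_cases h : x e = 0 <;> simp [h]
  -- Doubling the edges outside `x` keeps the degrees even and makes the support everything. There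
  -- is then a single component, whose parity is that of `x`.
  obtain ⟨g, hg1, hg2⟩ := exists_flow_of_even (s := s) (t := t) p (m := fun e => if x e = 0 then 2 else 1)
    (fun v => by simpa only [hcast] using hx v) (fun z y h1 h2 => by
      rw [← hpar]
      congr 1
      ext e
      rw [h1 e (by rw [hS]; exact hconn _ _), hcast])
  refine ⟨g, fun e he => ?_, fun e he => ?_, hg2⟩
  · have h := hg1 e
    rw [if_neg he] at h
    have h0 : g e ≠ 0 := by
      intro h0
      simp [h0] at h
    have h3 := abs_le.1 h.1
    push_cast at h3
    omega
  · have h := hg1 e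
    rw [if_pos he] at h
    have h3 := abs_le.1 h.1
    have h4 : (2 : ℤ) ∣ g e := by
      have := h.2
      rw [show ((2 : ℕ) : ZMod 2) = 0 from rfl] at this
      exact (ZMod.intCast_zmod_eq_zero_iff_dvd _ 2).1 this
    push_cast at h3
    omega

/-- The signed multigraph has a nowhere-zero `k`-flow with respect to the standard orientation. -/
def HasNZFlow (s t : E → V) (p : E → ZMod 2) (k : ℤ) : Prop :=
  ∃ f : E → ℤ, (∀ v, bd s t p f v = 0) ∧ ∀ e, f e ≠ 0 ∧ |f e| < k

omit [DecidableEq E] in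
lemma HasNZFlow.switch {p : E → ZMod 2} {k : ℤ} (c : V → ZMod 2) (h : HasNZFlow s t p k) :
    HasNZFlow s t (fun e => p e + (c (s e) + c (t e))) k := by
  obtain ⟨f, h1, h2⟩ := h
  refine ⟨fun e => sgn (c (s e)) * f e, fun v => by rw [bd_switch, h1, mul_zero], fun e => ?_⟩
  obtain ⟨h3, h4⟩ := h2 e
  refine ⟨mul_ne_zero (sgn_ne_zero _) h3, ?_⟩
  rw [abs_mul]
  rcases sgn_cases (c (s e)) with h | h <;> simpa [h] using h4

lemma even_iff_cast {n : ℤ} : (n : ZMod 2) = 0 ↔ (2 : ℤ) ∣ n := ZMod.intCast_zmod_eq_zero_iff_dvd n 2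

/-- A graph with a nowhere-zero `4`-flow is covered by two cycles. -/
lemma exists_cover_of_four_flow (h : HasNZFlow s t (fun _ => 0) 4) :
    ∃ x₁ x₂ : E → ZMod 2, (∀ v, bdTwo s t x₁ v = 0) ∧ (∀ v, bdTwo s t x₂ v = 0) ∧
      ∀ e, x₁ e = 0 → x₂ e ≠ 0 := by
  obtain ⟨f, hf1, hf2⟩ := h
  have hx : ∀ v, bdTwo s t (fun e => (f e : ZMod 2)) v = 0 := fun v => by
    rw [← bd_cast s t (fun _ => 0), hf1, Int.cast_zero]
  -- Subtracting a ±1-valued flow on the odd edges of `f` makes all values even. The half `g` is ±1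
  -- where `f` is even, since `f = ±2` there.
  obtain ⟨h, hh1, hh2, hh3⟩ := exists_flow_of_pos (fun _ => 0) hx fun _ _ => rfl
  have hdvd : ∀ e, (2 : ℤ) ∣ f e - h e := by
    intro e
    by_cases he : ((f e : ℤ) : ZMod 2) = 0
    · rw [hh2 e he, sub_zero]; exact even_iff_cast.1 he
    · have h1 := hh1 e he
      rw [even_iff_cast] at he
      omega
  choose g hg using hdvd
  refine ⟨fun e => (f e : ZMod 2), fun e => (g e : ZMod 2), hx, fun v => ?_, fun e he => ?_⟩
  · rw [← bd_cast s t (fun _ => 0)]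
    have h1 : bd s t (fun _ => 0) (fun e => 2 * g e) v = 0 := by
      have : (fun e => 2 * g e) = fun e => f e + (-1) * h e := by ext e; rw [← hg e]; ring
      rw [this, bd_add, bd_smul, hf1, hh3]; rfl
    rw [bd_smul] at h1
    have : bd s t (fun _ => 0) g v = 0 := by omega
    rw [this, Int.cast_zero]
  · have h1 := hg e
    rw [hh2 e he] at h1
    obtain ⟨h2, h3⟩ := hf2 e
    rw [abs_lt] at h3
    rw [ne_eq, even_iff_cast]
    omega

/-- A connected signed multigraph that is covered by two cycles with an even number of negative
edges each has a nowhere-zero `8`-flow. -/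
lemma hasNZFlow_of_even_cover {p x₁ x₂ : E → ZMod 2} (hconn : ∀ a b, conn s t Set.univ a b)
    (h₁ : ∀ v, bdTwo s t x₁ v = 0) (h₂ : ∀ v, bdTwo s t x₂ v = 0) (hp₁ : par p x₁ = 0)
    (hp₂ : par p x₂ = 0) (hcov : ∀ e, x₁ e = 0 → x₂ e ≠ 0) : HasNZFlow s t p 8 := by
  obtain ⟨f, hf1, hf2, hf3⟩ := exists_three_flow hconn h₁ hp₁
  obtain ⟨g, hg1, hg2, hg3⟩ := exists_three_flow hconn h₂ hp₂
  -- If `f` is 0 or ±2, then `g = ±1` by the covering and the value lies between 1 and 5 in absolute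
  -- value; if `f = ±1`, it is not divisible by 3 and is at most 1 + 6.
  refine ⟨fun e => f e + 3 * g e, fun v => by rw [bd_add, bd_smul, hf3, hg3]; rfl, fun e => ?_⟩
  show f e + 3 * g e ≠ 0 ∧ |f e + 3 * g e| < 8
  rw [abs_lt]
  by_cases he : x₁ e = 0
  · have h1 := hf2 e he
    have h2 := hg1 e (hcov e he)
    omega
  · have h1 := hf1 e he
    by_cases he2 : x₂ e = 0
    · have h2 := hg2 e he2
      omega
    · have h2 := hg1 e he2
      omega

end SignedFlow

/-! ### Directed paths and orientations with prescribed net outdegrees. -/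

namespace SignedFlow

/-- Either a path starts with an arc after which it avoids its initial vertex, or it is trivial. -/
lemma reflTransGen_last_departure {V : Type*} {r : V → V → Prop} {v w : V}
    (h : Relation.ReflTransGen r v w) :
    v = w ∨ ∃ v₁, r v v₁ ∧ v₁ ≠ v ∧
      Relation.ReflTransGen (fun a b => r a b ∧ a ≠ v ∧ b ≠ v) v₁ w := by
  induction h with
  | refl => exact Or.inl rfl
  | @tail b c _ hbc ih =>
    by_cases hc : c = v
    · exact Or.inl hc.symm
    right
    by_cases hb : b = v
    · exact ⟨c, hb ▸ hbc, hc, .refl⟩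
    rcases ih with rfl | ⟨v₁, h1, h2, h3⟩
    · exact absurd rfl hb
    · exact ⟨v₁, h1, h2, h3.tail ⟨hbc, hb, hc⟩⟩

lemma reflTransGen_imp {V : Type*} {r q : V → V → Prop} (hrq : ∀ a b, r a b → q a b) {v w : V}
    (h : Relation.ReflTransGen r v w) : Relation.ReflTransGen q v w :=
  Relation.ReflTransGen.mono hrq v w h

section Orientation

variable {V E : Type*} [Fintype V] [DecidableEq V] [Fintype E] [DecidableEq E] {s t : E → V}

/-- The arcs of the partial orientation `o`. -/
def Arc (s t : E → V) (o : E → ℤ) (a b : V) : Prop :=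
  ∃ e, (o e = 1 ∧ s e = a ∧ t e = b) ∨ (o e = -1 ∧ t e = a ∧ s e = b)

omit [Fintype V] in
-- Induction on the number of allowed vertices: after the last departure from `v` the path avoids
-- `v`, so the first arc is never used again.
lemma exists_directed_path_aux {o : E → ℤ} (n : ℕ) (A : Finset V) (hA : A.card = n) {v w : V}
    (h : Relation.ReflTransGen (fun a b => a ∈ A ∧ b ∈ A ∧ Arc s t o a b) v w) :
    ∃ z : E → ℤ, (∀ e, z e = 0 ∨ (z e = o e ∧ s e ∈ A ∧ t e ∈ A)) ∧
      ∀ x, bd s t (fun _ => 0) z x = (if v = x then 1 else 0) - (if w = x then 1 else 0) := by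
  induction n generalizing A v with
  | zero =>
    rw [Finset.card_eq_zero] at hA
    subst hA
    rcases reflTransGen_last_departure h with rfl | ⟨v₁, h1, -⟩
    · exact ⟨fun _ => 0, by simp, fun x => by rw [bd_zero, sub_self]⟩
    · simp at h1
  | succ n ih =>
    rcases reflTransGen_last_departure h with rfl | ⟨v₁, ⟨hv, hv₁, e₀, he₀⟩, hne, h2⟩
    · exact ⟨fun _ => 0, by simp, fun x => by rw [bd_zero, sub_self]⟩
    obtain ⟨z, hz1, hz2⟩ := ih (A.erase v) (by rw [Finset.card_erase_of_mem hv, hA]; rfl)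
      (reflTransGen_imp (fun _ _ ⟨⟨ha, hb, hab⟩, hav, hbv⟩ =>
        ⟨Finset.mem_erase.2 ⟨hav, ha⟩, Finset.mem_erase.2 ⟨hbv, hb⟩, hab⟩) h2)
    have hz0 : z e₀ = 0 := by
      rcases hz1 e₀ with h | ⟨-, h3, h4⟩
      · exact h
      · rcases he₀ with ⟨-, h5, -⟩ | ⟨-, h5, -⟩
        · exact absurd h5 (Finset.ne_of_mem_erase h3)
        · exact absurd h5 (Finset.ne_of_mem_erase h4)
    refine ⟨fun e => (if e = e₀ then o e₀ else 0) + z e, fun e => ?_, fun x => ?_⟩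
    · by_cases he : e = e₀
      · subst he
        right
        simp only [if_true, hz0, add_zero]
        rcases he₀ with ⟨-, rfl, rfl⟩ | ⟨-, rfl, rfl⟩
        · exact ⟨trivial, hv, hv₁⟩
        · exact ⟨trivial, hv₁, hv⟩
      · simp only [if_neg he, zero_add]
        exact (hz1 e).imp_right fun ⟨h3, h4, h5⟩ =>
          ⟨h3, Finset.mem_of_mem_erase h4, Finset.mem_of_mem_erase h5⟩
    · rw [bd_add, bd_single, hz2, sgn_zero]
      rcases he₀ with ⟨h3, rfl, rfl⟩ | ⟨h3, rfl, rfl⟩ <;> simp only [h3] <;> ring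

/-- A vertex that can be reached along arcs can be reached by a path that uses every arc at most
once. -/
lemma exists_directed_path {o : E → ℤ} {v w : V} (h : Relation.ReflTransGen (Arc s t o) v w) :
    ∃ z : E → ℤ, (∀ e, z e = 0 ∨ z e = o e) ∧
      ∀ x, bd s t (fun _ => 0) z x = (if v = x then 1 else 0) - (if w = x then 1 else 0) := by
  obtain ⟨z, h1, h2⟩ := exists_directed_path_aux _ Finset.univ rfl
    (reflTransGen_imp (fun a b hab => ⟨Finset.mem_univ a, Finset.mem_univ b, hab⟩) h)
  exact ⟨z, fun e => (h1 e).imp_right fun h => h.1, h2⟩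

omit [DecidableEq E] in
lemma sum_bd_eq (f : E → ℤ) (U : Finset V) :
    ∑ v ∈ U, bd s t (fun _ => 0) f v =
      ∑ e, f e * ((if s e ∈ U then 1 else 0) - (if t e ∈ U then 1 else 0)) := by
  have := sum_mul_bd s t (fun _ => 0) f fun v => if v ∈ U then 1 else 0
  simpa [sgn_zero] using this

/-- The number of edges between `U` and its complement. -/
def cut (s t : E → V) (U : Finset V) : Finset E :=
  Finset.univ.filter fun e => ¬ (s e ∈ U ↔ t e ∈ U)

/-- Hakimi's theorem: an orientation with prescribed net outdegrees exists if the obvious parity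
and cut conditions are satisfied. -/
theorem exists_orientation (b : V → ℤ)
    (hpar : ∀ v, ((b v : ℤ) : ZMod 2) = bdTwo s t (fun _ => 1) v) (hsum : ∑ v, b v = 0)
    (hcut : ∀ U : Finset V, ∑ v ∈ U, b v ≤ (cut s t U).card) :
    ∃ o : E → ℤ, (∀ e, o e = 1 ∨ o e = -1) ∧ ∀ v, bd s t (fun _ => 0) o v = b v := by
  -- Descent on the total deviation from the demand: reversing a directed path from a vertex with
  -- excess to one with deficit lowers it.
  suffices key : ∀ n : ℕ, ∀ o : E → ℤ, (∀ e, o e = 1 ∨ o e = -1) →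
      ∑ v, |bd s t (fun _ => 0) o v - b v| = n →
      ∃ o : E → ℤ, (∀ e, o e = 1 ∨ o e = -1) ∧ ∀ v, bd s t (fun _ => 0) o v = b v by
    obtain ⟨n, hn⟩ := Int.eq_ofNat_of_zero_le
      (Finset.sum_nonneg fun v (_ : v ∈ Finset.univ) => abs_nonneg (bd s t (fun _ => 0) (fun _ => 1) v - b v))
    exact key n (fun _ => 1) (fun _ => Or.inl rfl) hn
  intro n
  induction n using Nat.strong_induction_on with
  | _ n ih =>
  intro o ho hn
  by_cases hall : ∀ v, bd s t (fun _ => 0) o v ≤ b v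
  · refine ⟨o, ho, fun v => ?_⟩
    have h1 : ∑ v, (bd s t (fun _ => 0) o v - b v) = 0 := by
      rw [Finset.sum_sub_distrib, hsum, sum_bd_eq]
      simp
    have h2 := (Finset.sum_eq_zero_iff_of_nonpos fun v _ => sub_nonpos.2 (hall v)).1 h1 v
      (Finset.mem_univ v)
    omega
  push Not at hall
  obtain ⟨v, hv⟩ := hall
  classical
  -- Every edge between `U` and its complement is directed into `U`, so `U` has the least possible
  -- net outdegree; without a deficit in `U` the cut condition for the complement would fail.
  let U : Finset V := Finset.univ.filter fun w => Relation.ReflTransGen (Arc s t o) v w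
  have hU : ∀ w, w ∈ U ↔ Relation.ReflTransGen (Arc s t o) v w := fun w => by simp [U]
  obtain ⟨w, hw1, hw2⟩ : ∃ w ∈ U, bd s t (fun _ => 0) o w < b w := by
    by_contra! hno
    have h1 : ∑ w ∈ U, b w < ∑ w ∈ U, bd s t (fun _ => 0) o w :=
      Finset.sum_lt_sum hno ⟨v, (hU v).2 .refl, hv⟩
    have h2 : ∑ w ∈ U, bd s t (fun _ => 0) o w ≤ -((cut s t U).card : ℤ) := by
      rw [sum_bd_eq, cut, Finset.card_filter, Nat.cast_sum, ← Finset.sum_neg_distrib]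
      refine Finset.sum_le_sum fun e _ => ?_
      rcases ho e with he | he
      · have : s e ∈ U → t e ∈ U := fun h =>
          (hU _).2 (((hU _).1 h).tail ⟨e, Or.inl ⟨he, rfl, rfl⟩⟩)
        by_cases h3 : s e ∈ U
        · simp [h3, this h3]
        · by_cases h4 : t e ∈ U <;> simp [h3, h4, he]
      · have : t e ∈ U → s e ∈ U := fun h =>
          (hU _).2 (((hU _).1 h).tail ⟨e, Or.inr ⟨he, rfl, rfl⟩⟩)
        by_cases h3 : t e ∈ U
        · simp [h3, this h3]
        · by_cases h4 : s e ∈ U <;> simp [h3, h4, he]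
    have h3 := hcut Uᶜ
    have h4 : cut s t Uᶜ = cut s t U := by
      ext e
      simp only [cut, Finset.mem_filter, Finset.mem_compl, not_iff_not]
    have h5 := Finset.sum_add_sum_compl U b
    rw [h4] at h3
    omega
  obtain ⟨z, hz1, hz2⟩ := exists_directed_path ((hU w).1 hw1)
  have hbd : ∀ x, bd s t (fun _ => 0) (fun e => o e + (-2) * z e) x =
      bd s t (fun _ => 0) o x - 2 * (if v = x then 1 else 0) + 2 * (if w = x then 1 else 0) := by
    intro x
    rw [bd_add, bd_smul, hz2]
    ring
  have hvw : v ≠ w := by rintro rfl; omega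
  -- Deviations are even, so a change by 2 towards the demand cannot overshoot.
  have hev : ∀ x, (2 : ℤ) ∣ bd s t (fun _ => 0) o x - b x := by
    intro x
    rw [← even_iff_cast]
    push_cast
    rw [hpar, bd_cast, sub_eq_zero]
    congr 1
    ext e
    rcases ho e with h | h <;> rw [h] <;> rfl
  have hlt : ∑ x, |bd s t (fun _ => 0) (fun e => o e + (-2) * z e) x - b x| < n := by
    rw [← hn]
    refine Finset.sum_lt_sum (fun x _ => ?_) ⟨v, Finset.mem_univ v, ?_⟩
    · rw [hbd]
      have := hev x
      by_cases h1 : v = x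
      · subst h1; rw [if_pos rfl, if_neg hvw.symm, abs_le, abs_of_pos (by omega)]; omega
      · by_cases h2 : w = x
        · subst h2; rw [if_neg h1, if_pos rfl, abs_le, abs_of_neg (by omega)]; omega
        · rw [if_neg h1, if_neg h2]; simp
    · rw [hbd, if_pos rfl, if_neg hvw.symm, abs_lt, abs_of_pos (by omega)]
      have := hev v
      omega
  obtain ⟨k, hk⟩ := Int.eq_ofNat_of_zero_le
    (Finset.sum_nonneg fun x (_ : x ∈ Finset.univ) =>
      abs_nonneg (bd s t (fun _ => 0) (fun e => o e + (-2) * z e) x - b x))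
  refine ih k (by omega) _ (fun e => ?_) hk
  rcases hz1 e with h | h <;> rcases ho e with h' | h' <;> simp [h, h']

end Orientation

end SignedFlow

/-! ### Edge-disjoint odd cycles in Eulerian signed graphs. -/

namespace SignedFlow

universe u w

set_option linter.unusedSectionVars false
set_option linter.unusedSimpArgs false

/-- There are two edge-disjoint cycles each of which has an odd number of negative edges. -/
def HasDisjointOddCycles {V : Type u} {E : Type w} [DecidableEq V] [Fintype E] (s t : E → V)
    (p : E → ZMod 2) : Prop :=
  ∃ x y : E → ZMod 2, (∀ v, bdTwo s t x v = 0) ∧ (∀ v, bdTwo s t y v = 0) ∧ par p x = 1 ∧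
    par p y = 1 ∧ ∀ e, x e = 0 ∨ y e = 0

/-- No equivalent signature has exactly one negative edge. -/
def NoSingleton {V : Type u} {E : Type w} [DecidableEq E] (s t : E → V) (p : E → ZMod 2) : Prop :=
  ∀ (c : V → ZMod 2) (e₀ : E), ¬ ∀ e, p e + (c (s e) + c (t e)) = if e = e₀ then 1 else 0

variable {V : Type u} {E : Type w} [Fintype V] [DecidableEq V] [Fintype E] [DecidableEq E]

section Two

variable {s t : E → V} {e₁ e₂ a : E}

/-- The initial vertices after the ends of `e₁` and `e₂` have been moved to a new vertex. -/
def splitTail (s : E → V) (e₂ a : E) (e : {e : E // e ≠ a}) : Option V :=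
  if e.1 = e₂ then none else some (s e.1)

omit [Fintype V] [DecidableEq V] in
lemma sum_subtype_ne {M : Type*} [AddCommMonoid M] (a : E) (f : E → M) :
    ∑ e, f e = f a + ∑ e : {e : E // e ≠ a}, f e.1 := Fintype.sum_eq_add_sum_subtype_ne f a

/-- Net outdegrees in the graph in which `e₁` and `e₂` start at a new vertex. -/
def splitDemand (v x y : V) (u : Option V) : ℤ :=
  2 * (if u = none then 1 else 0) - 2 * (if u = some v then 1 else 0)
    + ((if u = some x then 1 else 0) - (if u = some y then 1 else 0))

lemma sum_splitDemand (v x y : V) (U : Finset (Option V)) :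
    ∑ u ∈ U, splitDemand v x y u = 2 * (if none ∈ U then 1 else 0)
      - 2 * (if some v ∈ U then 1 else 0)
      + ((if some x ∈ U then 1 else 0) - (if some y ∈ U then 1 else 0)) := by
  simp only [splitDemand, Finset.sum_add_distrib, Finset.sum_sub_distrib, ← Finset.mul_sum,
    Finset.sum_ite_eq']

/-- The vertex of the original graph. -/
def unsplit (v : V) (u : Option V) : V := u.getD v

/-- Identifying the new vertex with `s e₂` gives back the graph without `a`. -/
lemma bdTwo_split (hv₁ : t e₁ = s e₂) (x : {e : E // e ≠ a} → ZMod 2) (u : V) :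
    bdTwo (fun e : {e : E // e ≠ a} => s e.1) (fun e => t e.1) x u =
      ∑ u', (if unsplit (s e₂) u' = u then 1 else 0) *
        bdTwo (splitTail s e₂ a) (splitTail t e₁ a) x u' := by
  rw [← bdTwo_comp]
  have h1 : unsplit (s e₂) ∘ splitTail s e₂ a = fun e => s e.1 := by
    ext e
    by_cases h : e.1 = e₂ <;> simp [splitTail, h, unsplit]
  have h2 : unsplit (s e₂) ∘ splitTail t e₁ a = fun e => t e.1 := by
    ext e
    by_cases h : e.1 = e₁
    · simp [splitTail, h, unsplit, hv₁]
    · simp [splitTail, h, unsplit]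
  rw [h1, h2]

lemma bdTwo_splitTail_none (h₁ : e₁ ≠ a) (h₂ : e₂ ≠ a) (x : {e : E // e ≠ a} → ZMod 2) :
    bdTwo (splitTail s e₂ a) (splitTail t e₁ a) x none = x ⟨e₁, h₁⟩ + x ⟨e₂, h₂⟩ := by
  have h1 : ∀ e : {e : E // e ≠ a}, x e * ((if splitTail s e₂ a e = none then 1 else 0)
      + (if splitTail t e₁ a e = none then 1 else 0)) =
      (if e = ⟨e₁, h₁⟩ then x e else 0) + (if e = ⟨e₂, h₂⟩ then x e else 0) := by
    intro e
    simp only [splitTail, Subtype.ext_iff]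
    by_cases h3 : e.1 = e₁ <;> by_cases h4 : e.1 = e₂ <;> simp [h3, h4]
    all_goals split_ifs <;> ring
  simp [bdTwo, h1, Finset.sum_add_distrib]

/-- Deleting `a` changes degree parity only at its ends, and the new vertex takes two edge ends away
from `s e₂`. -/
lemma bdTwo_splitTail_some (hv₁ : t e₁ = s e₂) (h₁ : e₁ ≠ a) (h₂ : e₂ ≠ a)
    (heven : ∀ v, bdTwo s t (fun _ => 1) v = 0) (u : V) :
    bdTwo (splitTail s e₂ a) (splitTail t e₁ a) (fun _ => 1) (some u) =
      (if s a = u then 1 else 0) + (if t a = u then 1 else 0) := by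
  have h3 := heven u
  rw [bdTwo, sum_subtype_ne a] at h3
  have h4 := bdTwo_split (a := a) hv₁ (fun _ => 1) u
  rw [Fintype.sum_option, bdTwo_splitTail_none h₁ h₂, CharTwo.add_self_eq_zero, mul_zero,
    zero_add] at h4
  rw [Finset.sum_eq_single u (fun i _ hi => by simp [unsplit, hi]) (by simp)] at h4
  simp only [unsplit, Option.getD_some, if_true, one_mul] at h4
  rw [← h4]
  rw [one_mul] at h3
  exact (zmod_add_eq_zero.1 h3).symm

/-- Hakimi's theorem applies because a set that violates the cut condition would be a switching set
leaving a single negative edge. The two choices of `x` and `y` prescribe opposite imbalances at the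
ends of `a`. -/
lemma exists_split_orientation (hv₁ : t e₁ = s e₂) (h₁₂ : e₁ ≠ e₂) (h₁ : e₁ ≠ a) (h₂ : e₂ ≠ a)
    (heven : ∀ v, bdTwo s t (fun _ => 1) v = 0)
    (hsing : NoSingleton s t fun e => (if e = e₁ then 1 else 0) + (if e = e₂ then 1 else 0)
      + (if e = a then 1 else 0)) {x y : V} (hxy : x = s a ∧ y = t a ∨ x = t a ∧ y = s a) :
    ∃ o : {e : E // e ≠ a} → ℤ, (∀ e, o e = 1 ∨ o e = -1) ∧ ∀ u,
      bd (splitTail s e₂ a) (splitTail t e₁ a) (fun _ => 0) o u = splitDemand (s e₂) x y u := by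
  have hpar : ∀ u, ((splitDemand (s e₂) x y u : ℤ) : ZMod 2) =
      bdTwo (splitTail s e₂ a) (splitTail t e₁ a) (fun _ => 1) u := by
    intro u
    have h2 : (2 : ZMod 2) = 0 := rfl
    rcases u with _ | u
    · rw [bdTwo_splitTail_none h₁ h₂]
      simp [splitDemand, CharTwo.add_self_eq_zero, h2]
    · rw [bdTwo_splitTail_some hv₁ h₁ h₂ heven]
      unfold splitDemand
      push_cast
      simp only [h2, CharTwo.sub_eq_add, Option.some.injEq, zero_mul, zero_add,
        eq_comm (a := u)]
      rcases hxy with ⟨rfl, rfl⟩ | ⟨rfl, rfl⟩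
      · rfl
      · rw [add_comm]
  refine exists_orientation _ hpar ?_ fun U => ?_
  · rw [sum_splitDemand]; simp
  by_contra! hcon
  have hU := sum_splitDemand (s e₂) x y U
  -- The demand of `U` and the size of its cut agree modulo two, so a violation is by at least 2. As
  -- the demand is at most 3, `U` contains the new vertex but not `s e₂`, and its cut has at most
  -- one edge.
  have hmod : (((∑ u ∈ U, splitDemand (s e₂) x y u - (cut (splitTail s e₂ a) (splitTail t e₁ a) U).card
      : ℤ)) : ZMod 2) = 0 := by
    push_cast
    rw [sub_eq_zero, Finset.sum_congr rfl fun u _ => hpar u]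
    have h3 := sum_mul_bdTwo (splitTail s e₂ a) (splitTail t e₁ a) (fun _ => 1)
      fun u => if u ∈ U then 1 else 0
    simp only [ite_mul, one_mul, zero_mul, Finset.sum_ite_mem, Finset.univ_inter] at h3
    rw [h3, cut, Finset.card_filter]
    push_cast
    refine Finset.sum_congr rfl fun e _ => ?_
    by_cases h4 : splitTail s e₂ a e ∈ U <;> by_cases h5 : splitTail t e₁ a e ∈ U <;> simp [h4, h5]
    rfl
  rw [even_iff_cast] at hmod
  have hnone : none ∈ U := by
    by_contra h
    rw [if_neg h] at hU
    split_ifs at hU <;> omega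
  have hsome : some (s e₂) ∉ U := by
    intro h
    rw [if_pos h] at hU
    split_ifs at hU <;> omega
  rw [if_pos hnone, if_neg hsome] at hU
  -- Switching at `U`: apart from `a`, the negative edges become exactly the cut edges in the split
  -- graph, since moving the ends of `e₁` and `e₂` to the new vertex accounts for their negative
  -- signs.
  let c : V → ZMod 2 := fun u => if some u ∈ U then 1 else 0
  have hc : ∀ e : {e : E // e ≠ a}, (if e.1 = e₁ then 1 else 0) + (if e.1 = e₂ then 1 else 0)
      + (if e.1 = a then 1 else 0) + (c (s e.1) + c (t e.1)) =
        if e ∈ cut (splitTail s e₂ a) (splitTail t e₁ a) U then 1 else 0 := by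
    rintro ⟨e, he⟩
    simp only [cut, Finset.mem_filter, Finset.mem_univ, true_and, splitTail, if_neg he, c]
    by_cases h3 : e = e₁
    · subst h3
      rw [hv₁]
      by_cases h4 : some (s e) ∈ U <;> simp [h₁₂, h4, hsome, hnone]
      rfl
    · by_cases h4 : e = e₂
      · subst h4
        by_cases h5 : some (t e) ∈ U <;> simp [h3, h5, hsome, hnone]
        rfl
      · by_cases h5 : some (s e) ∈ U <;> by_cases h6 : some (t e) ∈ U <;> simp [h3, h4, h5, h6]
        rfl
  have ha : (if a = e₁ then 1 else 0) + (if a = e₂ then 1 else 0)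
      + (if a = a then 1 else 0) + (c (s a) + c (t a)) =
        1 + ((if some x ∈ U then 1 else 0) + (if some y ∈ U then 1 else 0) : ZMod 2) := by
    rw [if_neg h₁.symm, if_neg h₂.symm, if_pos rfl]
    rcases hxy with ⟨rfl, rfl⟩ | ⟨rfl, rfl⟩
    · simp [c]
    · simp [c, add_comm]
  have hk : (cut (splitTail s e₂ a) (splitTail t e₁ a) U).card = 0 ∨
      (cut (splitTail s e₂ a) (splitTail t e₁ a) U).card = 1 := by
    split_ifs at hU <;> omega
  -- An empty cut means demand 2, so `a` stays negative and is alone. A single cut edge means demand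
  -- 3, so `a` is switched to positive and that edge is alone.
  rcases hk with hk | hk
  · refine hsing c a fun e => ?_
    by_cases he : e = a
    · subst he
      rw [ha, if_pos rfl]
      rw [hk] at hmod
      by_cases h3 : some x ∈ U <;> by_cases h4 : some y ∈ U <;> simp [h3, h4] at hU ⊢
      · rfl
      · omega
      · omega
    · rw [hc ⟨e, he⟩, Finset.card_eq_zero.1 hk, if_neg he]
      simp
  · obtain ⟨e₀, he₀⟩ := Finset.card_eq_one.1 hk
    refine hsing c e₀.1 fun e => ?_
    by_cases he : e = a
    · subst he
      rw [ha, if_neg e₀.2.symm]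
      rw [hk] at hmod
      by_cases h3 : some x ∈ U <;> by_cases h4 : some y ∈ U <;> simp [h3, h4] at hU ⊢
      · omega
      · rfl
      · omega
      · omega
    · rw [hc ⟨e, he⟩, he₀]
      simp [Subtype.ext_iff]

/-- Two disjoint odd cycles if the negative edges are three, two of which are adjacent. -/
lemma hasDisjointOddCycles_of_three (hv₁ : t e₁ = s e₂) (h₁₂ : e₁ ≠ e₂) (h₁ : e₁ ≠ a) (h₂ : e₂ ≠ a)
    (heven : ∀ v, bdTwo s t (fun _ => 1) v = 0)
    (hsing : NoSingleton s t fun e => (if e = e₁ then 1 else 0) + (if e = e₂ then 1 else 0)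
      + (if e = a then 1 else 0)) :
    HasDisjointOddCycles s t fun e => (if e = e₁ then 1 else 0) + (if e = e₂ then 1 else 0)
      + (if e = a then 1 else 0) := by
  obtain ⟨o, ho1, ho2⟩ := exists_split_orientation hv₁ h₁₂ h₁ h₂ heven hsing
    (Or.inl ⟨rfl, rfl⟩)
  obtain ⟨q, hq1, hq2⟩ := exists_split_orientation hv₁ h₁₂ h₁ h₂ heven hsing
    (Or.inr ⟨rfl, rfl⟩)
  have hpar : ∀ x : E → ZMod 2, par (fun e => (if e = e₁ then 1 else 0)
      + (if e = e₂ then 1 else 0) + (if e = a then 1 else 0)) x = x e₁ + x e₂ + x a := by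
    intro x
    simp [par, mul_add, Finset.sum_add_distrib]
  have hext : ∀ (x : E → ZMod 2) (u : V), bdTwo s t x u =
      x a * ((if s a = u then 1 else 0) + (if t a = u then 1 else 0)) +
        bdTwo (fun e : {e : E // e ≠ a} => s e.1) (fun e => t e.1) (fun e => x e.1) u := fun x u => by
    rw [bdTwo, sum_subtype_ne a]
    rfl
  -- Half the difference and half the sum of the orientations have disjoint supports. The former
  -- carries a unit from `s a` to `t a`, the latter two units from the new vertex to `s e₂`.
  have hd : ∀ e, ∃ d : ℤ, o e - q e = 2 * d := fun e => by
    rcases ho1 e with h | h <;> rcases hq1 e with h' | h' <;> rw [h, h']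
    exacts [⟨0, rfl⟩, ⟨1, rfl⟩, ⟨-1, rfl⟩, ⟨0, rfl⟩]
  choose d hd using hd
  have hg : ∀ e, ∃ d : ℤ, o e + q e = 2 * d := fun e => by
    rcases ho1 e with h | h <;> rcases hq1 e with h' | h' <;> rw [h, h']
    exacts [⟨1, rfl⟩, ⟨0, rfl⟩, ⟨0, rfl⟩, ⟨-1, rfl⟩]
  choose g hg using hg
  have hdb : ∀ u, bd (splitTail s e₂ a) (splitTail t e₁ a) (fun _ => 0) d u =
      (if u = some (s a) then 1 else 0) - (if u = some (t a) then 1 else 0) := by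
    intro u
    have h3 : bd (splitTail s e₂ a) (splitTail t e₁ a) (fun _ => 0) (fun e => 2 * d e) u =
        bd (splitTail s e₂ a) (splitTail t e₁ a) (fun _ => 0) (fun e => o e + (-1) * q e) u := by
      congr 1; ext e; rw [← hd e]; ring
    rw [bd_smul, bd_add, bd_smul, ho2, hq2] at h3
    simp only [splitDemand] at h3
    linarith
  have hgb : ∀ u, bd (splitTail s e₂ a) (splitTail t e₁ a) (fun _ => 0) g u =
      2 * (if u = none then 1 else 0) - 2 * (if u = some (s e₂) then 1 else 0) := by
    intro u
    have h3 : bd (splitTail s e₂ a) (splitTail t e₁ a) (fun _ => 0) (fun e => 2 * g e) u =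
        bd (splitTail s e₂ a) (splitTail t e₁ a) (fun _ => 0) (fun e => o e + q e) u := by
      congr 1; ext e; rw [← hg e]
    rw [bd_smul, bd_add, ho2, hq2] at h3
    simp only [splitDemand] at h3
    linarith
  -- Otherwise the component of the new vertex in the support of `g` would have net outflow 2 and no
  -- edge to leave by.
  have hconn : conn (splitTail s e₂ a) (splitTail t e₁ a) {e | o e = q e} none (some (s e₂)) := by
    classical
    by_contra hno
    have h3 := sum_mul_bd (splitTail s e₂ a) (splitTail t e₁ a) (fun _ => 0) g
      fun u => if conn (splitTail s e₂ a) (splitTail t e₁ a) {e | o e = q e} none u then 1 else 0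
    rw [Finset.sum_eq_zero (s := Finset.univ (α := {e : E // e ≠ a})) (fun e _ => ?_)] at h3
    · simp only [hgb, Fintype.sum_option, if_true, reduceCtorEq, if_false, Option.some.injEq] at h3
      rw [if_pos (Setoid.refl' _ _)] at h3
      rw [Finset.sum_eq_single (s e₂)] at h3
      · rw [if_neg hno] at h3
        norm_num at h3
      · intro b _ hb
        simp [hb]
      · simp
    · by_cases he : o e = q e
      · have h4 : conn (splitTail s e₂ a) (splitTail t e₁ a) {e | o e = q e} none
            (splitTail s e₂ a e) ↔ conn (splitTail s e₂ a) (splitTail t e₁ a) {e | o e = q e} none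
            (splitTail t e₁ a e) :=
          ⟨fun h => Setoid.trans' _ h (conn_edge he),
            fun h => Setoid.trans' _ h (Setoid.symm' _ (conn_edge he))⟩
        simp only [h4, sgn_zero, one_mul, sub_self, mul_zero]
      · have : g e = 0 := by
          have := hg e
          rcases ho1 e with h | h <;> rcases hq1 e with h' | h' <;> rw [h, h'] at this he <;>
            first | exact absurd rfl he | omega
        rw [this, zero_mul]
  obtain ⟨z, hz1, hz2⟩ := exists_bdTwo_path hconn
  -- The path `z` from the new vertex to `s e₂` closes up in the original graph and contains exactly
  -- one of `e₁`, `e₂`. The difference `d`, closed up by `a`, has even degree at the new vertex, so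
  -- it contains both or neither.
  refine ⟨fun e => if h : e = a then 0 else z ⟨e, h⟩,
    fun e => if h : e = a then 1 else (d ⟨e, h⟩ : ZMod 2), fun u => ?_, fun u => ?_, ?_, ?_, ?_⟩
  · rw [hext]
    have h3 : (fun e : {e : E // e ≠ a} => if h : e.1 = a then 0 else z ⟨e.1, h⟩) = z := by
      ext e; rw [dif_neg e.2]
    rw [h3, bdTwo_split hv₁, dif_pos rfl, zero_mul, zero_add]
    simp [hz2, Fintype.sum_option, unsplit, mul_add, Finset.sum_add_distrib,
      CharTwo.add_self_eq_zero]
    by_cases h : s e₂ = u <;> simp [h, CharTwo.add_self_eq_zero]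
  · rw [hext]
    have h3 : (fun e : {e : E // e ≠ a} => if h : e.1 = a then (1 : ZMod 2) else (d ⟨e.1, h⟩ : ZMod 2))
        = fun e => (d e : ZMod 2) := by
      ext e; rw [dif_neg e.2]
    rw [h3, bdTwo_split hv₁, dif_pos rfl, one_mul, zmod_add_eq_zero]
    simp only [← bd_cast _ _ (fun _ => 0) d, hdb]
    push_cast
    simp [Fintype.sum_option, unsplit, mul_add, Finset.sum_add_distrib, CharTwo.sub_eq_add]
    by_cases h : s a = u <;> by_cases h' : t a = u <;> simp [h, h']
  · rw [hpar, dif_neg h₁, dif_neg h₂, dif_pos rfl, add_zero, ← bdTwo_splitTail_none (s := s) (t := t),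
      hz2]
    simp
  · have h3 := bdTwo_splitTail_none (s := s) (t := t) h₁ h₂ fun e => (d e : ZMod 2)
    rw [← bd_cast _ _ (fun _ => 0) d, hdb] at h3
    rw [hpar, dif_neg h₁, dif_neg h₂, dif_pos rfl, ← h3]
    simp
  · intro e
    by_cases he : e = a
    · left; simp [he]
    · simp only [dif_neg he]
      by_cases h3 : o ⟨e, he⟩ = q ⟨e, he⟩
      · right
        have := hd ⟨e, he⟩
        rw [h3] at this
        have : d ⟨e, he⟩ = 0 := by omega
        rw [this, Int.cast_zero]
      · left
        by_contra h4
        exact h3 (hz1 _ h4)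

end Two

section Merge

variable {s t : E → V} {p : E → ZMod 2} {e₁ e₂ : E}

lemma bdTwo_swap {s t s' t' : E → V}
    (h : ∀ e, (s' e = s e ∧ t' e = t e) ∨ (s' e = t e ∧ t' e = s e)) (x : E → ZMod 2) (v : V) :
    bdTwo s' t' x v = bdTwo s t x v := by
  refine Finset.sum_congr rfl fun e _ => ?_
  rcases h e with ⟨h1, h2⟩ | ⟨h1, h2⟩
  · rw [h1, h2]
  · rw [h1, h2, add_comm]

lemma NoSingleton.swap {s t s' t' : E → V}
    (h : ∀ e, (s' e = s e ∧ t' e = t e) ∨ (s' e = t e ∧ t' e = s e)) (hn : NoSingleton s t p) :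
    NoSingleton s' t' p := by
  intro c e₀ hc
  refine hn c e₀ fun e => ?_
  rw [← hc e]
  rcases h e with ⟨h1, h2⟩ | ⟨h1, h2⟩
  · rw [h1, h2]
  · rw [h1, h2, add_comm (c (t e))]

lemma NoSingleton.switch (hn : NoSingleton s t p) (c : V → ZMod 2) :
    NoSingleton s t fun e => p e + (c (s e) + c (t e)) := by
  intro d e₀ hd
  refine hn (fun v => c v + d v) e₀ fun e => ?_
  rw [← hd e]
  ring

/-- The second ends after `e₁` and `e₂` have been merged to a single edge `e₁`. -/
def mergeHead (t : E → V) (e₁ e₂ : E) (e : {e : E // e ≠ e₂}) : V :=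
  if e.1 = e₁ then t e₂ else t e.1

/-- The parities after `e₁` and `e₂` have been merged to a single edge `e₁`. -/
def mergePar (p : E → ZMod 2) (e₁ e₂ : E) (e : {e : E // e ≠ e₂}) : ZMod 2 :=
  p e.1 + if e.1 = e₁ then p e₂ else 0

/-- The set of edges of the original graph. -/
def unmerge (h₁₂ : e₁ ≠ e₂) (x : {e : E // e ≠ e₂} → ZMod 2) (e : E) : ZMod 2 :=
  if h : e = e₂ then x ⟨e₁, h₁₂⟩ else x ⟨e, h⟩

/-- An edge set that treats `e₁` and `e₂` alike pairs with a weight as if their weights were added;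
this transfers boundaries and parities. -/
lemma sum_unmerge (h₁₂ : e₁ ≠ e₂) (x : {e : E // e ≠ e₂} → ZMod 2) (f : E → ZMod 2) :
    ∑ e, unmerge h₁₂ x e * f e = ∑ e : {e : E // e ≠ e₂}, x e *
      (f e.1 + if e.1 = e₁ then f e₂ else 0) := by
  have h1 : ∀ e : {e : E // e ≠ e₂}, x e * (f e.1 + if e.1 = e₁ then f e₂ else 0) =
      x e * f e.1 + if e = ⟨e₁, h₁₂⟩ then x e * f e₂ else 0 := by
    intro e
    simp only [Subtype.ext_iff]
    split_ifs <;> ring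
  rw [sum_subtype_ne e₂, Finset.sum_congr rfl fun e _ => h1 e, Finset.sum_add_distrib,
    Finset.sum_ite_eq' , add_comm]
  congr 1
  · refine Finset.sum_congr rfl fun e _ => ?_
    rw [unmerge, dif_neg e.2]
  · simp [unmerge]

lemma bdTwo_unmerge (hv₁ : t e₁ = s e₂) (h₁₂ : e₁ ≠ e₂) (x : {e : E // e ≠ e₂} → ZMod 2) (v : V) :
    bdTwo s t (unmerge h₁₂ x) v =
      bdTwo (fun e : {e : E // e ≠ e₂} => s e.1) (mergeHead t e₁ e₂) x v := by
  rw [bdTwo, sum_unmerge]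
  refine Finset.sum_congr rfl fun e _ => ?_
  congr 1
  by_cases h : e.1 = e₁
  · simp only [h, if_true, mergeHead, hv₁]
    linear_combination CharTwo.add_self_eq_zero (if s e₂ = v then (1 : ZMod 2) else 0)
  · simp [h, mergeHead]

lemma par_unmerge (h₁₂ : e₁ ≠ e₂) (x : {e : E // e ≠ e₂} → ZMod 2) :
    par p (unmerge h₁₂ x) = par (mergePar p e₁ e₂) x := sum_unmerge h₁₂ x p

lemma unmerge_one (h₁₂ : e₁ ≠ e₂) : unmerge h₁₂ (fun _ => 1) = fun _ => 1 := by
  ext e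
  simp [unmerge]

lemma HasDisjointOddCycles.of_merge (hv₁ : t e₁ = s e₂) (h₁₂ : e₁ ≠ e₂)
    (h : HasDisjointOddCycles (fun e : {e : E // e ≠ e₂} => s e.1) (mergeHead t e₁ e₂)
      (mergePar p e₁ e₂)) : HasDisjointOddCycles s t p := by
  obtain ⟨x, y, hx, hy, hpx, hpy, hxy⟩ := h
  refine ⟨unmerge h₁₂ x, unmerge h₁₂ y, fun v => ?_, fun v => ?_, ?_, ?_, fun e => ?_⟩
  · rw [bdTwo_unmerge hv₁, hx]
  · rw [bdTwo_unmerge hv₁, hy]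
  · rw [par_unmerge, hpx]
  · rw [par_unmerge, hpy]
  · unfold unmerge
    split_ifs
    exacts [hxy _, hxy _]

/-- Lift the switching that isolates one negative edge `a`. Splitting the merged edge again leaves
one negative edge, which is excluded, or makes both halves negative besides `a`. -/
lemma hasDisjointOddCycles_of_merge_singleton (hv₁ : t e₁ = s e₂) (h₁₂ : e₁ ≠ e₂)
    (heven : ∀ v, bdTwo s t (fun _ => 1) v = 0) (hsing : NoSingleton s t p)
    (h : ¬ NoSingleton (fun e : {e : E // e ≠ e₂} => s e.1) (mergeHead t e₁ e₂)
      (mergePar p e₁ e₂)) : HasDisjointOddCycles s t p := by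
  simp only [NoSingleton, not_forall, not_exists, not_not] at h
  obtain ⟨c, ⟨a, ha⟩, hc⟩ := h
  have hne : ∀ e, e ≠ e₁ → e ≠ e₂ → p e + (c (s e) + c (t e)) = if e = a then 1 else 0 := by
    intro e h1 h2
    simpa [mergePar, mergeHead, h1] using hc ⟨e, h2⟩
  have hsum : (p e₁ + (c (s e₁) + c (t e₁))) + (p e₂ + (c (s e₂) + c (t e₂))) =
      if e₁ = a then 1 else 0 := by
    have h3 := hc ⟨e₁, h₁₂⟩
    simp only [mergePar, mergeHead, if_true, Subtype.mk.injEq] at h3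
    rw [← h3, hv₁]
    linear_combination CharTwo.add_self_eq_zero (c (s e₂))
  by_cases h1 : e₁ = a
  · subst h1
    rw [if_pos rfl] at hsum
    rcases zmod_cases (p e₁ + (c (s e₁) + c (t e₁))) with h3 | h3
    · rw [h3, zero_add] at hsum
      refine absurd (fun e => ?_) (hsing c e₂)
      by_cases h4 : e = e₁
      · subst h4; rw [h3, if_neg ha]
      · by_cases h5 : e = e₂
        · subst h5; rw [hsum, if_pos rfl]
        · rw [hne e h4 h5, if_neg h4, if_neg h5]
    · rw [h3, add_eq_left] at hsum
      refine absurd (fun e => ?_) (hsing c e₁)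
      by_cases h4 : e = e₁
      · subst h4; rw [h3, if_pos rfl]
      · by_cases h5 : e = e₂
        · subst h5; rw [hsum, if_neg h4]
        · rw [hne e h4 h5, if_neg h4]
  · rw [if_neg h1, zmod_add_eq_zero] at hsum
    rcases zmod_cases (p e₁ + (c (s e₁) + c (t e₁))) with h3 | h3
    · rw [h3] at hsum
      refine absurd (fun e => ?_) (hsing c a)
      by_cases h4 : e = e₁
      · subst h4; rw [h3, if_neg h1]
      · by_cases h5 : e = e₂
        · subst h5; rw [← hsum, if_neg ha.symm]
        · rw [hne e h4 h5]
    · rw [h3] at hsum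
      have hN : (fun e => p e + (c (s e) + c (t e))) = fun e => (if e = e₁ then 1 else 0)
          + (if e = e₂ then 1 else 0) + (if e = a then 1 else 0) := by
        ext e
        by_cases h4 : e = e₁
        · subst h4; simp [h3, h₁₂, h1]
        · by_cases h5 : e = e₂
          · subst h5; simp [← hsum, h4, ha.symm]
          · simp [hne e h4 h5, h4, h5]
      obtain ⟨x, y, hx, hy, hpx, hpy, hxy⟩ := hasDisjointOddCycles_of_three hv₁ h₁₂ h1 ha.symm heven
        (hN ▸ hsing.switch c)
      rw [← hN] at hpx hpy
      rw [par_switch s t p x hx] at hpx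
      rw [par_switch s t p y hy] at hpy
      exact ⟨x, y, hx, hy, hpx, hpy, hxy⟩

/-- With even degrees and no two adjacent edges every edge is a loop, so any two negative edges are
the desired cycles. -/
lemma hasDisjointOddCycles_of_disjoint (heven : ∀ v, bdTwo s t (fun _ => 1) v = 0)
    (hodd : par p (fun _ => 1) = 1) (hsing : NoSingleton s t p)
    (hdisj : ∀ e₁ e₂, e₁ ≠ e₂ → s e₁ ≠ s e₂ ∧ s e₁ ≠ t e₂) : HasDisjointOddCycles s t p := by
  have hloop : ∀ e, t e = s e := by
    intro e
    have h1 := heven (s e)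
    rw [bdTwo, Finset.sum_eq_single e (fun b _ hb => by
      rw [if_neg (hdisj e b hb.symm).1.symm, if_neg (hdisj e b hb.symm).2.symm]; simp)
      (by simp)] at h1
    by_contra h
    simp [h] at h1
  have hcyc : ∀ x v, bdTwo s t x v = 0 := fun x v =>
    Finset.sum_eq_zero fun e _ => by rw [hloop, CharTwo.add_self_eq_zero, mul_zero]
  obtain ⟨a, ha⟩ : ∃ a, p a = 1 := by
    by_contra! h
    have : par p (fun _ => 1) = 0 := Finset.sum_eq_zero fun e _ => by
      rw [(zmod_cases (p e)).resolve_right (h e), mul_zero]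
    rw [this] at hodd
    exact zero_ne_one hodd
  have := hsing 0 a
  push Not at this
  obtain ⟨b, hb⟩ := this
  have hba : b ≠ a := by rintro rfl; simp [ha] at hb
  simp only [Pi.zero_apply, add_zero, if_neg hba] at hb
  refine ⟨fun e => if e = a then 1 else 0, fun e => if e = b then 1 else 0, hcyc _, hcyc _,
    by simpa [par] using ha, by simpa [par] using (zmod_cases _).resolve_left hb, fun e => ?_⟩
  by_cases h : e = a
  · right; exact if_neg fun h' => hba (h'.symm.trans h)
  · left; exact if_neg h

end Merge

/-- An Eulerian signed graph with an odd number of negative edges has two edge-disjoint odd cycles,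
unless it is equivalent to one with a single negative edge. -/
theorem hasDisjointOddCycles (n : ℕ) {E : Type w} [Fintype E] [DecidableEq E] (hn : Fintype.card E = n)
    {s t : E → V} {p : E → ZMod 2} (heven : ∀ v, bdTwo s t (fun _ => 1) v = 0)
    (hodd : par p (fun _ => 1) = 1) (hsing : NoSingleton s t p) : HasDisjointOddCycles s t p := by
  induction n generalizing E with
  | zero =>
    have := Fintype.card_eq_zero_iff.1 hn
    simp [par] at hodd
  | succ n ih =>
    have hmerge : ∀ (s t : E → V) (e₁ e₂ : E), (∀ v, bdTwo s t (fun _ => 1) v = 0) →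
        NoSingleton s t p → e₁ ≠ e₂ → t e₁ = s e₂ → HasDisjointOddCycles s t p := by
      intro s t e₁ e₂ heven hsing h₁₂ hv
      by_cases h : NoSingleton (fun e : {e : E // e ≠ e₂} => s e.1) (mergeHead t e₁ e₂)
        (mergePar p e₁ e₂)
      · refine HasDisjointOddCycles.of_merge hv h₁₂ (ih ?_ (fun v => ?_) ?_ h)
        · simp [Fintype.card_subtype_compl, hn]
        · rw [← bdTwo_unmerge hv h₁₂, unmerge_one, heven]
        · rw [← par_unmerge h₁₂, unmerge_one, hodd]
      · exact hasDisjointOddCycles_of_merge_singleton hv h₁₂ heven hsing h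
    by_cases hdisj : ∀ e₁ e₂, e₁ ≠ e₂ → s e₁ ≠ s e₂ ∧ s e₁ ≠ t e₂
    · exact hasDisjointOddCycles_of_disjoint heven hodd hsing hdisj
    · push Not at hdisj
      obtain ⟨e₂, e₁, h₁₂, h⟩ := hdisj
      -- Exchanging the ends of one edge makes two adjacent edges consecutive and affects neither
      -- cycles nor switching.
      have hsw : ∃ s' t' : E → V, (∀ e, (s' e = s e ∧ t' e = t e) ∨ (s' e = t e ∧ t' e = s e)) ∧
          t' e₁ = s' e₂ := by
        by_cases h3 : s e₂ = s e₁
        · refine ⟨fun e => if e = e₁ then t e else s e, fun e => if e = e₁ then s e else t e,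
            fun e => ?_, by simp [h₁₂, h3]⟩
          by_cases h4 : e = e₁ <;> simp [h4]
        · exact ⟨s, t, fun e => Or.inl ⟨rfl, rfl⟩, (h h3).symm⟩
      obtain ⟨s', t', hst, hv⟩ := hsw
      obtain ⟨x, y, hx, hy, hrest⟩ := hmerge s' t' e₁ e₂ (fun v => by rw [bdTwo_swap hst, heven])
        (hsing.swap hst) h₁₂.symm hv
      exact ⟨x, y, fun v => by rw [← bdTwo_swap hst, hx], fun v => by rw [← bdTwo_swap hst, hy],
        hrest⟩

end SignedFlow

/-! ### Extremal choice of an odd cycle. -/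

namespace SignedFlow

section Selection

variable {V E : Type*} [DecidableEq V] [Fintype E] {s t : E → V} {p : E → ZMod 2}

/-- No edge of the support crosses between `P` and its complement, so at each vertex the restriction
keeps all or nothing. -/
lemma bdTwo_restrict (P : V → Prop) [DecidablePred P] {x : E → ZMod 2}
    (h : ∀ e, x e ≠ 0 → (P (s e) ↔ P (t e))) (v : V) :
    bdTwo s t (fun e => if P (s e) then x e else 0) v = if P v then bdTwo s t x v else 0 := by
  have key : bdTwo s t (fun e => if P (s e) then x e else 0) v =
      ∑ e, if P v then x e * ((if s e = v then 1 else 0) + (if t e = v then 1 else 0)) else 0 := by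
    refine Finset.sum_congr rfl fun e _ => ?_
    by_cases hx : x e = 0
    · simp [hx]
    have := h e hx
    by_cases h1 : s e = v
    · subst h1; by_cases h3 : P (s e) <;> simp [h3]
    · by_cases h2 : t e = v
      · subst h2; by_cases h3 : P (t e) <;> simp [this, h3]
      · simp [h1, h2]
  rw [key]
  split_ifs
  · rfl
  · simp

lemma bd_restrict (P : V → Prop) [DecidablePred P] {f : E → ℤ}
    (h : ∀ e, f e ≠ 0 → (P (s e) ↔ P (t e))) (v : V) :
    bd s t p (fun e => if P (s e) then f e else 0) v = if P v then bd s t p f v else 0 := by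
  have key : bd s t p (fun e => if P (s e) then f e else 0) v = ∑ e, if P v then
      f e * ((if s e = v then 1 else 0) - sgn (p e) * (if t e = v then 1 else 0)) else 0 := by
    refine Finset.sum_congr rfl fun e _ => ?_
    by_cases hx : f e = 0
    · simp [hx]
    have := h e hx
    by_cases h1 : s e = v
    · subst h1; by_cases h3 : P (s e) <;> simp [h3]
    · by_cases h2 : t e = v
      · subst h2; by_cases h3 : P (t e) <;> simp [this, h3]
      · simp [h1, h2]
  rw [key]
  split_ifs
  · rfl
  · simp

omit [DecidableEq V] in
/-- Some class contains an odd number of negative edges if the whole graph does. -/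
lemma exists_par_class [Fintype V] (S : Setoid V) [DecidableRel S] (x : E → ZMod 2)
    (hx : par p x = 1) : ∃ z, par p (fun e => if S z (s e) then x e else 0) = 1 := by
  classical
  by_contra! h
  have : par p x = ∑ q : Quotient S, par p (fun e => if S q.out (s e) then x e else 0) := by
    simp only [par]
    rw [Finset.sum_comm]
    refine Finset.sum_congr rfl fun e _ => ?_
    have h1 : ∀ q : Quotient S, S q.out (s e) ↔ q = Quotient.mk S (s e) := by
      intro q
      rw [← Quotient.eq (r := S), Quotient.out_eq]
    simp [h1]
  rw [this, Finset.sum_eq_zero fun q _ => (zmod_cases _).resolve_right (h _)] at hx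
  exact zero_ne_one hx

omit [DecidableEq V] [Fintype E] in
/-- A class is connected by its own edges. -/
lemma conn_inter_class {S : Set E} {z q : V} (h : conn s t S z q) :
    conn s t (S ∩ {e | conn s t S z (s e)}) z q := by
  have key : ∀ {a b : V}, conn s t S a b → conn s t S z a →
      conn s t (S ∩ {e | conn s t S z (s e)}) a b := by
    intro a b hab
    induction hab with
    | rel a b h' =>
      obtain ⟨e, he, rfl, rfl⟩ := h'
      exact fun h => conn_edge ⟨he, h⟩
    | refl a => exact fun _ => Setoid.refl' _ a
    | symm a b h' ih => exact fun h => Setoid.symm' _ (ih (Setoid.trans' _ h (Setoid.symm' _ h')))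
    | trans a b c h1 _ ih1 ih2 =>
      exact fun h => Setoid.trans' _ (ih1 h) (ih2 (Setoid.trans' _ h h1))
  exact key h (Setoid.refl' _ z)

omit [DecidableEq V] [Fintype E] in
lemma conn_iff_of_mem {S : Set E} {e : E} (he : e ∈ S) (z : V) :
    conn s t S z (s e) ↔ conn s t S z (t e) :=
  ⟨fun h => Setoid.trans' _ h (conn_edge he),
    fun h => Setoid.trans' _ h (Setoid.symm' _ (conn_edge he))⟩

variable [Fintype V]

/-- `R` is an odd cycle, and without the edges of `R` the class of `z` contains an odd cycle. -/
def IsOddPair (s t : E → V) (p R : E → ZMod 2) (z : V) : Prop :=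
  (∀ v, bdTwo s t R v = 0) ∧ par p R = 1 ∧ ∃ y : E → ZMod 2,
    (∀ e, y e ≠ 0 → R e = 0 ∧ conn s t {e | R e = 0} z (s e)) ∧ (∀ v, bdTwo s t y v = 0) ∧
    par p y = 1

lemma HasDisjointOddCycles.exists_isOddPair (h : HasDisjointOddCycles s t p) :
    ∃ R z, IsOddPair s t p R z := by
  classical
  obtain ⟨x, y, hx, hy, hpx, hpy, hxy⟩ := h
  obtain ⟨z, hz⟩ := exists_par_class (s := s) (conn s t {e | x e = 0}) y hpy
  refine ⟨x, z, hx, hpx, _, fun e he => ?_, fun v => ?_, hz⟩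
  · have : conn s t {e | x e = 0} z (s e) ∧ y e ≠ 0 := by simpa using he
    exact ⟨(hxy e).resolve_right this.2, this.1⟩
  · rw [bdTwo_restrict]
    · simp [hy]
    · exact fun e he => conn_iff_of_mem (S := {e | x e = 0}) ((hxy e).resolve_right he) z

open Classical in
/-- The number of vertices of a class. -/
noncomputable def classCard (s t : E → V) (R : E → ZMod 2) (z : V) : ℕ :=
  (Finset.univ.filter fun q => conn s t {e | R e = 0} z q).card

/-- If a class has an odd number of negative edges, then some pair has a larger class. -/
lemma IsOddPair.exists_classCard_lt (hconn : ∀ a b, conn s t Set.univ a b)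
    (heven : ∀ v, bdTwo s t (fun _ => 1) v = 0) (hodd : par p (fun _ => 1) = 1)
    {R : E → ZMod 2} {z : V} (hR : IsOddPair s t p R z) {w : V} {x : E → ZMod 2}
    (hx1 : ∀ e, R e = 0 → conn s t {e | R e = 0} w (s e) → x e = 1)
    (hx0 : ∀ e, ¬ (R e = 0 ∧ conn s t {e | R e = 0} w (s e)) → x e = 0) (hx : par p x ≠ 0) :
    ∃ R', IsOddPair s t p R' z ∧ classCard s t R z < classCard s t R' z := by
  classical
  obtain ⟨hR1, hR2, y, hy1, hy2, hy3⟩ := hR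
  set S := conn s t {e | R e = 0} with hS
  have hcomp : ∀ v, bdTwo s t (fun e => 1 + R e) v = 0 := fun v => by
    rw [bdTwo_add, heven, hR1, add_zero]
  have hone : ∀ e, R e = 0 ↔ 1 + R e ≠ 0 := by
    intro e
    rcases zmod_cases (R e) with h | h <;> rw [h] <;> decide
  -- The complement of `R` is even because the whole graph and `R` are odd. So if the class of `z`
  -- is itself odd, some other class is odd too.
  obtain ⟨z', hz1, hz2⟩ : ∃ z', ¬ S z z' ∧
      par p (fun e => if S z' (s e) then 1 + R e else 0) = 1 := by
    have hxw : x = fun e => if S w (s e) then 1 + R e else 0 := by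
      ext e
      by_cases h1 : R e = 0
      · by_cases h2 : S w (s e)
        · rw [hx1 e h1 h2, if_pos h2, h1, add_zero]
        · rw [hx0 e (fun h => h2 h.2), if_neg h2]
      · have h3 : 1 + R e = 0 := by by_contra h; exact h1 ((hone e).2 h)
        rw [hx0 e (fun h => h1 h.1), h3, ite_self]
    by_cases hw : S z w
    · have hsplit : par p (fun e => if S w (s e) then 0 else 1 + R e) = 1 := by
        have h1 : par p (fun e => 1 + R e) = par p (fun e => if S w (s e) then 1 + R e else 0) +
            par p (fun e => if S w (s e) then 0 else 1 + R e) := by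
          rw [← par_add]
          congr 1
          ext e
          split_ifs <;> simp
        rw [par_add, hodd, hR2, ← hxw, zmod_ne_zero.1 hx] at h1
        have h2 : (1 : ZMod 2) + 1 = 0 := rfl
        rw [h2] at h1
        exact (zmod_add_eq_zero.1 h1.symm).symm
      obtain ⟨z', hz'⟩ := exists_par_class (s := s) S _ hsplit
      by_cases h1 : S z z'
      · exfalso
        have h2 : (fun e => if S z' (s e) then (if S w (s e) then 0 else 1 + R e) else 0) =
            fun _ => 0 := by
          ext e
          by_cases h3 : S z' (s e)
          · rw [if_pos h3, if_pos (Setoid.trans' _ (Setoid.symm' _ hw) (Setoid.trans' _ h1 h3))]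
          · rw [if_neg h3]
        rw [h2] at hz'
        simp [par] at hz'
      · refine ⟨z', h1, Eq.trans ?_ hz'⟩
        congr 1
        ext e
        by_cases h3 : S z' (s e)
        · rw [if_pos h3, if_pos h3, if_neg fun h4 => h1
            (Setoid.trans' _ (Setoid.trans' _ hw h4) (Setoid.symm' _ h3))]
        · rw [if_neg h3, if_neg h3]
    · exact ⟨w, hw, hxw ▸ zmod_ne_zero.1 hx⟩
  set R' : E → ZMod 2 := fun e => if S z' (s e) then 1 + R e else 0 with hR'
  have hR'0 : ∀ e, R e ≠ 0 → R' e = 0 := by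
    intro e he
    have h3 : 1 + R e = 0 := by by_contra h; exact he ((hone e).2 h)
    simp only [hR', h3, ite_self]
  have hle : ∀ q, S z q → conn s t {e | R' e = 0} z q := by
    intro q hq
    refine conn_mono ?_ (conn_inter_class hq)
    rintro e ⟨-, he⟩
    exact if_neg fun h => hz1 (Setoid.trans' _ he (Setoid.symm' _ h))
  refine ⟨R', ⟨fun v => ?_, hz2, y, fun e he => ?_, hy2, hy3⟩, ?_⟩
  · rw [hR', bdTwo_restrict]
    · simp [hcomp]
    · exact fun e he => conn_iff_of_mem (S := {e | R e = 0}) ((hone e).2 he) z'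
  · exact ⟨if_neg fun h => hz1 (Setoid.trans' _ (hy1 e he).2 (Setoid.symm' _ h)),
      hle _ (hy1 e he).2⟩
  -- By connectedness some edge leaves the old class of `z`. It lies in `R`, hence outside `R'`, so
  -- the new class gains its other end.
  · obtain ⟨e, he⟩ : ∃ e, ¬ (S z (s e) ↔ S z (t e)) := by
      by_contra! h
      have := conn_const (c := fun v => S z v) (fun e _ => propext (h e)) (hconn z z')
      exact hz1 (this ▸ Setoid.refl' _ z)
    have hRe : R e ≠ 0 := fun h => he (conn_iff_of_mem (S := {e | R e = 0}) h z)
    have hiff := conn_iff_of_mem (s := s) (t := t) (S := {e | R' e = 0}) (hR'0 e hRe) z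
    refine Finset.card_lt_card ((Finset.ssubset_iff_of_subset fun q hq => ?_).2 ?_)
    · simp only [Finset.mem_filter, Finset.mem_univ, true_and] at hq ⊢
      exact hle q hq
    · by_cases h1 : S z (s e)
      · exact ⟨t e, by simpa using hiff.1 (hle _ h1),
          by simpa using fun h => he ⟨fun _ => h, fun _ => h1⟩⟩
      · have h2 : S z (t e) := by by_contra h2; exact he ⟨fun h => absurd h h1, fun h => absurd h h2⟩
        exact ⟨s e, by simpa using hiff.2 (hle _ h2), by simpa using h1⟩

/-- A minimal odd cycle whose deletion leaves only classes with an even number of negative edges,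
at least one of which contains an odd cycle. -/
theorem exists_isOddPair_minimal (hconn : ∀ a b, conn s t Set.univ a b)
    (heven : ∀ v, bdTwo s t (fun _ => 1) v = 0) (hodd : par p (fun _ => 1) = 1)
    (hdis : HasDisjointOddCycles s t p) :
    ∃ R z, IsOddPair s t p R z ∧
      (∀ x : E → ZMod 2, (∀ e, x e ≠ 0 → R e ≠ 0) → (∀ v, bdTwo s t x v = 0) → par p x = 1 →
        x = R) ∧
      ∀ w, ∀ x : E → ZMod 2, (∀ e, R e = 0 → conn s t {e | R e = 0} w (s e) → x e = 1) →
        (∀ e, ¬ (R e = 0 ∧ conn s t {e | R e = 0} w (s e)) → x e = 0) → par p x = 0 := by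
  classical
  -- Lexicographic maximum: first the size of the class of `z`, then the number of edges outside
  -- `R`. The second part yields minimality of `R`, the first evenness of the classes.
  let N : (E → ZMod 2) × V → ℕ := fun a => classCard s t a.1 a.2 * (Fintype.card E + 1) +
    (Finset.univ.filter fun e => a.1 e = 0).card
  obtain ⟨R₀, z₀, h₀⟩ := hdis.exists_isOddPair
  obtain ⟨⟨R, z⟩, hRz, hmax⟩ := Set.exists_max_image {a : (E → ZMod 2) × V | IsOddPair s t p a.1 a.2} N
    (Set.toFinite _) ⟨(R₀, z₀), h₀⟩
  refine ⟨R, z, hRz, fun x hx1 hx2 hx3 => ?_, fun w x hx1 hx0 => ?_⟩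
  · obtain ⟨hR1, hR2, y, hy1, hy2, hy3⟩ := hRz
    have hsub : {e | R e = 0} ⊆ {e | x e = 0} := fun e he => by
      by_contra h
      exact hx1 e h he
    have h1 := hmax (x, z) ⟨hx2, hx3, y, fun e he => ⟨hsub (hy1 e he).1,
      conn_mono hsub (hy1 e he).2⟩, hy2, hy3⟩
    have h2 : classCard s t R z ≤ classCard s t x z := Finset.card_le_card fun q hq => by
      simp only [Finset.mem_filter, Finset.mem_univ, true_and] at hq ⊢
      exact conn_mono hsub hq
    have hsub' : (Finset.univ.filter fun e => R e = 0) ⊆ Finset.univ.filter fun e => x e = 0 := by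
      intro e he
      simp only [Finset.mem_filter, Finset.mem_univ, true_and] at he ⊢
      exact hsub he
    have h3 := Finset.card_le_card hsub'
    have h4 := Nat.mul_le_mul_right (Fintype.card E + 1) h2
    have h5 := Finset.eq_of_subset_of_card_le hsub' (by simp only [N] at h1; omega)
    ext e
    have h6 : R e = 0 ↔ x e = 0 := by simpa using Finset.ext_iff.1 h5 e
    rcases zmod_cases (x e) with h | h <;> rcases zmod_cases (R e) with h' | h' <;>
      simp_all
  · by_contra hx
    obtain ⟨R', hR'1, hR'2⟩ := IsOddPair.exists_classCard_lt hconn heven hodd hRz hx1 hx0 hx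
    have h1 := hmax (R', z) hR'1
    have h2 : (Finset.univ.filter fun e => R e = 0).card ≤ Fintype.card E := Finset.card_le_univ _
    have h3 := Nat.mul_le_mul_right (Fintype.card E + 1) (Nat.succ_le_of_lt hR'2)
    simp only [N] at h1 h3
    rw [Nat.succ_mul] at h3
    omega

end Selection

end SignedFlow

/-! ### Balanced orientations of `C` and lifting of paths. -/

namespace SignedFlow

set_option linter.unusedSectionVars false

section Directed

variable {V Q E : Type*} [Fintype V] [DecidableEq V] [Fintype E] [DecidableEq E]
  {s t : E → V} {p : E → ZMod 2} {C : Set E} {κ : V → Q} {o : E → ℤ}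

/-- `o` orients the edges of `C`, all of which are positive, such that every vertex is balanced, and
the fibres of `κ` are the classes of `C`. -/
structure IsBalanced (s t : E → V) (p : E → ZMod 2) (C : Set E) (κ : V → Q) (o : E → ℤ) : Prop where
  eq_iff : ∀ a b, κ a = κ b ↔ conn s t C a b
  value : ∀ e ∈ C, o e = 1 ∨ o e = -1
  eq_zero : ∀ e ∉ C, o e = 0
  par_eq : ∀ e ∈ C, p e = 0
  bd_eq : ∀ v, bd s t p o v = 0

lemma bd_congr_par {q : E → ZMod 2} {f : E → ℤ} (h : ∀ e, f e ≠ 0 → p e = q e) (v : V) :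
    bd s t p f v = bd s t q f v := by
  refine Finset.sum_congr rfl fun e _ => ?_
  by_cases hf : f e = 0
  · simp [hf]
  · rw [h e hf]

namespace IsBalanced

variable (h : IsBalanced s t p C κ o)

include h

lemma mem {e : E} (he : o e ≠ 0) : e ∈ C := by
  by_contra h'
  exact he (h.eq_zero e h')

lemma map_eq {e : E} (he : e ∈ C) : κ (s e) = κ (t e) := (h.eq_iff _ _).2 (conn_edge he)

/-- The classes are strongly connected. -/
lemma reflTransGen {a b : V} (hab : κ a = κ b) : Relation.ReflTransGen (Arc s t o) a b := by
  classical
  -- All arcs across the boundary of the reachable set enter it, yet its net outflow is zero by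
  -- balance. So no edge of `C` crosses.
  let U : Finset V := Finset.univ.filter fun v => Relation.ReflTransGen (Arc s t o) a v
  have hU : ∀ {v w}, v ∈ U → Arc s t o v w → w ∈ U := by
    intro v w hv hvw
    simp only [U, Finset.mem_filter, Finset.mem_univ, true_and] at hv ⊢
    exact hv.tail hvw
  have hsum := sum_bd_eq (s := s) (t := t) o U
  rw [Finset.sum_eq_zero fun v _ => by
    rw [← bd_congr_par (p := p) fun e he => h.par_eq e (h.mem he), h.bd_eq]] at hsum
  have hle : ∀ e ∈ Finset.univ, o e * ((if s e ∈ U then 1 else 0) - (if t e ∈ U then 1 else 0)) ≤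
      0 := by
    intro e _
    by_cases he : e ∈ C
    · rcases h.value e he with h1 | h1
      · have h2 : s e ∈ U → t e ∈ U := fun h2 => hU h2 ⟨e, Or.inl ⟨h1, rfl, rfl⟩⟩
        rw [h1]
        by_cases h3 : s e ∈ U
        · simp [h3, h2 h3]
        · by_cases h4 : t e ∈ U <;> simp [h3, h4]
      · have h2 : t e ∈ U → s e ∈ U := fun h2 => hU h2 ⟨e, Or.inr ⟨h1, rfl, rfl⟩⟩
        rw [h1]
        by_cases h3 : t e ∈ U
        · simp [h3, h2 h3]
        · by_cases h4 : s e ∈ U <;> simp [h3, h4]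
    · simp [h.eq_zero e he]
  have hzero := (Finset.sum_eq_zero_iff_of_nonpos hle).1 hsum.symm
  have hconst := conn_const (s := s) (t := t) (S := C) (c := fun v => v ∈ U) (fun e he => by
    have h1 := hzero e (Finset.mem_univ e)
    have h2 : o e ≠ 0 := by rcases h.value e he with h2 | h2 <;> rw [h2] <;> decide
    have h3 := (mul_eq_zero.1 h1).resolve_left h2
    by_cases h4 : s e ∈ U <;> by_cases h5 : t e ∈ U <;> simp [h4, h5] at h3 ⊢)
    ((h.eq_iff _ _).1 hab)
  have ha : a ∈ U := by simp [U, Relation.ReflTransGen.refl]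
  have hb : b ∈ U := hconst ▸ ha
  simpa [U] using hb

lemma exists_path {a b : V} (hab : κ a = κ b) : ∃ z : E → ℤ,
    (∀ e, z e = 0 ∨ (z e = o e ∧ e ∈ C ∧ κ (s e) = κ a)) ∧
    ∀ x, bd s t p z x = (if a = x then 1 else 0) - (if b = x then 1 else 0) := by
  classical
  let A : Finset V := Finset.univ.filter fun v => κ v = κ a
  have harc : ∀ {v w}, Arc s t o v w → κ v = κ w := by
    rintro v w ⟨e, ⟨h1, rfl, rfl⟩ | ⟨h1, rfl, rfl⟩⟩
    · exact h.map_eq (h.mem (by omega))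
    · exact (h.map_eq (h.mem (by omega))).symm
  have key : Relation.ReflTransGen (fun v w => v ∈ A ∧ w ∈ A ∧ Arc s t o v w) a b ∧ b ∈ A := by
    have := h.reflTransGen hab
    clear hab
    induction this with
    | refl => exact ⟨Relation.ReflTransGen.refl, by simp [A]⟩
    | @tail c d _ h2 ih =>
      have h3 := harc h2
      have h4 := ih.2
      simp only [A, Finset.mem_filter, Finset.mem_univ, true_and] at h4
      have h5 : d ∈ A := by
        simpa only [A, Finset.mem_filter, Finset.mem_univ, true_and] using h3 ▸ h4
      exact ⟨ih.1.tail ⟨ih.2, h5, h2⟩, h5⟩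
  obtain ⟨z, hz1, hz2⟩ := exists_directed_path_aux _ A rfl key.1
  have hz3 : ∀ e, z e ≠ 0 → e ∈ C := by
    intro e he
    rcases hz1 e with h1 | h1
    · exact absurd h1 he
    · exact h.mem (h1.1 ▸ he)
  refine ⟨z, fun e => ?_, fun x => ?_⟩
  · by_cases he : z e = 0
    · exact Or.inl he
    · obtain ⟨h1, h2, -⟩ := (hz1 e).resolve_left he
      exact Or.inr ⟨h1, hz3 e he, by simpa [A] using h2⟩
  · rw [bd_congr_par (q := fun _ => 0) fun e he => h.par_eq e (hz3 e he), hz2]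

/-- A path that is traversed with sign `η`. -/
lemma exists_signed_path (η : ZMod 2) {a b : V} (hab : κ a = κ b) : ∃ z : E → ℤ,
    (∀ e, z e = 0 ∨ (z e = o e ∧ e ∈ C ∧ κ (s e) = κ a)) ∧
    ∀ x, bd s t p z x = sgn η * (if a = x then 1 else 0) - sgn η * (if b = x then 1 else 0) := by
  rcases sgn_cases η with hη | hη
  · obtain ⟨z, h1, h2⟩ := h.exists_path hab
    exact ⟨z, h1, fun x => by rw [h2, hη]; ring⟩
  -- A negative unit from `a` to `b` is a positive unit from `b` to `a`; strong connectivity lets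
  -- either run along `o`.
  · obtain ⟨z, h1, h2⟩ := h.exists_path hab.symm
    exact ⟨z, fun e => by rw [hab]; exact h1 e, fun x => by rw [h2, hη]; ring⟩

end IsBalanced

/-- Adjacency of classes by edges from `S`. -/
def ClassAdj (s t : E → V) (κ : V → Q) (S : Set E) (a b : Q) : Prop :=
  ∃ e ∈ S, (κ (s e) = a ∧ κ (t e) = b) ∨ (κ (t e) = a ∧ κ (s e) = b)

lemma exists_bd_traverse {a c : Q} {e : E}
    (he : (κ (s e) = a ∧ κ (t e) = c) ∨ (κ (t e) = a ∧ κ (s e) = c)) (η : ZMod 2) :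
    ∃ (u₁ u₂ : V) (k : ℤ), κ u₁ = a ∧ κ u₂ = c ∧ (k = 1 ∨ k = -1) ∧
      ∀ x, bd s t p (fun e' => if e' = e then k else 0) x =
        sgn η * (if u₁ = x then 1 else 0) - sgn (η + p e) * (if u₂ = x then 1 else 0) := by
  have hpp := sgn_mul_self (p e)
  rcases he with ⟨h1, h2⟩ | ⟨h1, h2⟩
  · refine ⟨s e, t e, sgn η, h1, h2, sgn_cases η, fun x => ?_⟩
    rw [bd_single, sgn_add]
    ring
  · refine ⟨t e, s e, -sgn (η + p e), h1, h2, ?_, fun x => ?_⟩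
    · rcases sgn_cases (η + p e) with h3 | h3 <;> rw [h3] <;> decide
    · rw [bd_single, sgn_add]
      linear_combination (sgn η * (if t e = x then 1 else 0)) * hpp

/-- A path in the graph of classes lifts to a signed path whose edges from `C` are traversed along
their directions. -/
lemma IsBalanced.exists_lift [DecidableEq Q] (h : IsBalanced s t p C κ o) {S : Set E} (hS : ∀ e ∈ S, e ∉ C)
    (n : ℕ) (A : Finset Q) (hA : A.card = n) {a b : Q}
    (hab : Relation.ReflTransGen (fun c d => c ∈ A ∧ d ∈ A ∧ ClassAdj s t κ S c d) a b)
    {u : V} (hu : κ u = a) (η : ZMod 2) :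
    ∃ (w : V) (ε : ZMod 2) (g : E → ℤ), κ w = b ∧
      (∀ x, bd s t p g x = sgn η * (if u = x then 1 else 0) - sgn ε * (if w = x then 1 else 0)) ∧
      (∀ e ∈ C, g e = 0 ∨ (g e = o e ∧ κ (s e) ∈ A ∧ κ (s e) ≠ b)) ∧
      ∀ e ∉ C, g e = 0 ∨ ((g e = 1 ∨ g e = -1) ∧ e ∈ S ∧ κ (s e) ∈ A ∧ κ (t e) ∈ A) := by
  induction n generalizing A a u η with
  | zero =>
    rw [Finset.card_eq_zero] at hA
    subst hA
    rcases reflTransGen_last_departure hab with rfl | ⟨c, h1, -⟩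
    · exact ⟨u, η, fun _ => 0, hu, fun x => by rw [bd_zero]; ring, fun e _ => Or.inl rfl,
        fun e _ => Or.inl rfl⟩
    · simp at h1
  | succ n ih =>
    rcases reflTransGen_last_departure hab with rfl | ⟨c, ⟨ha, hc, e, heS, he⟩, hca, hcb⟩
    · exact ⟨u, η, fun _ => 0, hu, fun x => by rw [bd_zero]; ring, fun e _ => Or.inl rfl,
        fun e _ => Or.inl rfl⟩
    have heC := hS e heS
    have hA' : (A.erase a).card = n := by rw [Finset.card_erase_of_mem ha, hA]; rfl
    have hcb' : Relation.ReflTransGen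
        (fun c d => c ∈ A.erase a ∧ d ∈ A.erase a ∧ ClassAdj s t κ S c d) c b := by
      refine reflTransGen_imp ?_ hcb
      rintro x y ⟨⟨hx, hy, hxy⟩, hxa, hya⟩
      exact ⟨Finset.mem_erase.2 ⟨hxa, hx⟩, Finset.mem_erase.2 ⟨hya, hy⟩, hxy⟩
    have hba : b ≠ a := by
      rcases hcb.cases_tail with rfl | ⟨d, -, h2⟩
      · exact hca
      · exact h2.2.2
    -- Move inside the class `a` to the end of the departing edge, traverse it, and continue with
    -- the sign it imposes. As the rest avoids `a`, each class is crossed at most once; the last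
    -- class is left untouched.
    obtain ⟨u₁, u₂, k, hu₁, hu₂, hk, hkb⟩ := exists_bd_traverse (p := p) he η
    obtain ⟨z, hz1, hz2⟩ := h.exists_signed_path η (hu.trans hu₁.symm)
    obtain ⟨w, ε, g, hw, hg1, hg2, hg3⟩ := ih _ hA' hcb' hu₂ (η + p e)
    have hzC : ∀ e', e' ∉ C → z e' = 0 := fun e' h' => (hz1 e').resolve_right fun h1 => h' h1.2.1
    have hge : g e = 0 := by
      rcases hg3 e heC with h1 | ⟨-, -, h2, h3⟩
      · exact h1
      · rcases he with ⟨h4, -⟩ | ⟨h4, -⟩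
        · rw [h4] at h2; simp at h2
        · rw [h4] at h3; simp at h3
    refine ⟨w, ε, fun e' => (z e' + if e' = e then k else 0) + g e', hw, fun x => ?_,
      fun e' he' => ?_, fun e' he' => ?_⟩
    · rw [bd_add, bd_add, hz2, hkb, hg1]
      ring
    · have hne : e' ≠ e := by rintro rfl; exact heC he'
      simp only [if_neg hne, add_zero]
      rcases hz1 e' with h1 | ⟨h1, -, h2⟩
      · rcases hg2 e' he' with h3 | ⟨h3, h4, h5⟩
        · left; omega
        · right; exact ⟨by omega, Finset.mem_of_mem_erase h4, h5⟩
      · rcases hg2 e' he' with h3 | ⟨-, h4, -⟩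
        · right; exact ⟨by omega, by rw [h2, hu]; exact ha, by rw [h2, hu]; exact hba.symm⟩
        · rw [h2, hu] at h4; simp at h4
    · simp only [hzC e' he', zero_add]
      by_cases hne : e' = e
      · subst hne
        rw [if_pos rfl, hge, add_zero]
        right
        refine ⟨hk, heS, ?_⟩
        rcases he with ⟨h1, h2⟩ | ⟨h1, h2⟩ <;> rw [h1, h2]
        · exact ⟨ha, hc⟩
        · exact ⟨hc, ha⟩
      · rw [if_neg hne, zero_add]
        rcases hg3 e' he' with h1 | ⟨h1, h2, h3, h4⟩
        · exact Or.inl h1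
        · exact Or.inr ⟨h1, h2, Finset.mem_of_mem_erase h3, Finset.mem_of_mem_erase h4⟩

end Directed

end SignedFlow

/-! ### Lollipops: an odd cycle with a tail. -/

namespace SignedFlow

set_option linter.unusedSectionVars false

section Lollipop

variable {V Q E : Type*} [Fintype V] [DecidableEq V] [Fintype Q] [DecidableEq Q] [Fintype E]
  [DecidableEq E] {s t : E → V} {p : E → ZMod 2} {C : Set E} {κ : V → Q} {o : E → ℤ}

/-- Otherwise the class of `a` in the support would contain exactly one of the two odd vertices. -/
lemma conn_of_bdTwo {x : E → ZMod 2} {a b : V}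
    (hx : ∀ v, bdTwo s t x v = (if a = v then 1 else 0) + (if b = v then 1 else 0)) :
    conn s t {e | x e ≠ 0} a b := by
  classical
  by_contra hno
  have h := sum_mul_bdTwo s t x fun v => if conn s t {e | x e ≠ 0} a v then 1 else 0
  rw [Finset.sum_eq_zero (s := (Finset.univ : Finset E)) (fun e _ => ?_)] at h
  · simp only [hx, mul_add, Finset.sum_add_distrib, mul_ite, mul_one, mul_zero,
      Finset.sum_ite_eq, Finset.mem_univ, if_true] at h
    rw [if_pos (Setoid.refl' _ a), if_neg hno] at h
    simp at h
  · by_cases he : x e = 0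
    · rw [he, zero_mul]
    · simp only [conn_iff_of_mem (s := s) (t := t) (S := {e | x e ≠ 0}) he a,
        CharTwo.add_self_eq_zero, mul_zero]

lemma ClassAdj.symm {S : Set E} {a b : Q} (h : ClassAdj s t κ S a b) : ClassAdj s t κ S b a := by
  obtain ⟨e, he, h1 | h1⟩ := h
  · exact ⟨e, he, Or.inr h1.symm⟩
  · exact ⟨e, he, Or.inl h1.symm⟩

/-- Edges of `C` become trivial after contraction. With `κ = id` and `C = ∅` this merely turns
connectivity into an explicit path. -/
lemma reflTransGen_of_conn (hC : ∀ e ∈ C, κ (s e) = κ (t e)) {S : Set E} {v w : V}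
    (h : conn s t S v w) : Relation.ReflTransGen (ClassAdj s t κ (S \ C)) (κ v) (κ w) := by
  induction h with
  | rel a b h =>
    obtain ⟨e, he, rfl, rfl⟩ := h
    by_cases heC : e ∈ C
    · rw [hC e heC]
    · exact Relation.ReflTransGen.single ⟨e, ⟨he, heC⟩, Or.inl ⟨rfl, rfl⟩⟩
  | refl a => exact Relation.ReflTransGen.refl
  | symm a b _ ih =>
    have : Std.Symm (ClassAdj s t κ (S \ C)) := ⟨fun _ _ => ClassAdj.symm⟩
    exact Relation.ReflTransGen.stdSymm.symm _ _ ih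
  | trans a b c _ _ h1 h2 => exact h1.trans h2

lemma IsBalanced.conn_of_reflTransGen (h : IsBalanced s t p C κ o) {S : Set E} (hC : C ⊆ S) {u : V}
    {b : Q} (hb : Relation.ReflTransGen (ClassAdj s t κ S) (κ u) b) {v : V} (hv : κ v = b) :
    conn s t S u v := by
  have hκ : ∀ {a b}, κ a = κ b → conn s t S a b := fun hab => conn_mono hC ((h.eq_iff _ _).1 hab)
  induction hb generalizing v with
  | refl => exact hκ hv.symm
  | tail _ h1 ih =>
    obtain ⟨e, he, ⟨h2, h3⟩ | ⟨h2, h3⟩⟩ := h1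
    · exact Setoid.trans' _ (Setoid.trans' _ (ih h2) (conn_edge he)) (hκ (h3.trans hv.symm))
    · exact Setoid.trans' _ (Setoid.trans' _ (ih h2) (Setoid.symm' _ (conn_edge he)))
        (hκ (h3.trans hv.symm))

omit [Fintype Q] [DecidableEq Q] in
/-- The part of a path after its last vertex with the property `P`. -/
lemma reflTransGen_last {r : Q → Q → Prop} {P : Q → Prop} {x j : Q} (hx : P x)
    (h : Relation.ReflTransGen r x j) : ∃ a, P a ∧ Relation.ReflTransGen r x a ∧
      (j = a ∨ ¬ P j) ∧
      Relation.ReflTransGen (fun c d => (c = a ∨ ¬ P c) ∧ (d = a ∨ ¬ P d) ∧ r c d) a j := by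
  induction h with
  | refl => exact ⟨x, hx, Relation.ReflTransGen.refl, Or.inl rfl, Relation.ReflTransGen.refl⟩
  | @tail j k h1 h2 ih =>
    by_cases hk : P k
    · exact ⟨k, hk, h1.tail h2, Or.inl rfl, Relation.ReflTransGen.refl⟩
    · obtain ⟨a, h3, h4, h5, h6⟩ := ih
      exact ⟨a, h3, h4, Or.inr hk, h6.tail ⟨h5, Or.inr hk, h2⟩⟩

/-- A minimal odd cycle of the graph of classes lifts to a closed signed path. -/
lemma IsBalanced.exists_loop (h : IsBalanced s t p C κ o) {R : E → ZMod 2}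
    (hRC : ∀ e, R e ≠ 0 → e ∉ C) (hR : ∀ q, bdTwo (κ ∘ s) (κ ∘ t) R q = 0) (hodd : par p R = 1)
    (hmin : ∀ x : E → ZMod 2, (∀ e, x e ≠ 0 → R e ≠ 0) →
      (∀ q, bdTwo (κ ∘ s) (κ ∘ t) x q = 0) → par p x = 1 → x = R)
    {d : E} (hd : R d ≠ 0) {a : Q} (ha : κ (s d) = a ∨ κ (t d) = a) :
    ∃ (r w : V) (ε : ZMod 2) (g : E → ℤ), κ r = a ∧ κ w = a ∧
      (∀ x, bd s t p g x = (if r = x then 1 else 0) - sgn ε * (if w = x then 1 else 0)) ∧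
      (∀ e ∈ C, g e = 0 ∨ (g e = o e ∧ κ (s e) ≠ a ∧
        ∃ d, R d ≠ 0 ∧ (κ (s d) = κ (s e) ∨ κ (t d) = κ (s e)))) ∧
      ∀ e ∉ C, (R e ≠ 0 → g e = 1 ∨ g e = -1) ∧ (R e = 0 → g e = 0) := by
  classical
  have hdC := hRC d hd
  obtain ⟨c, hc⟩ : ∃ c, (κ (s d) = a ∧ κ (t d) = c) ∨ (κ (t d) = a ∧ κ (s d) = c) := by
    rcases ha with ha | ha
    · exact ⟨_, Or.inl ⟨ha, rfl⟩⟩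
    · exact ⟨_, Or.inr ⟨ha, rfl⟩⟩
  obtain ⟨r, u, k, hr, hu, hk, hkb⟩ := exists_bd_traverse (p := p) hc 0
  have hconn : conn (κ ∘ s) (κ ∘ t) {e | R e ≠ 0 ∧ e ≠ d} c a := by
    have h1 := conn_of_bdTwo (s := κ ∘ s) (t := κ ∘ t)
      (x := fun e => R e + if e = d then 1 else 0) (a := c) (b := a) fun q => by
        rw [bdTwo_add, hR, bdTwo_single, zero_add]
        rcases hc with ⟨h1, h2⟩ | ⟨h1, h2⟩ <;> simp only [Function.comp, h1, h2]
        exact add_comm _ _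
    refine conn_mono (fun e he => ?_) h1
    have h2 : R e + (if e = d then 1 else 0) ≠ 0 := he
    by_cases hed : e = d
    · subst hed
      rw [if_pos rfl, zmod_ne_zero.1 hd] at h2
      exact absurd rfl h2
    · rw [if_neg hed, add_zero] at h2
      exact ⟨h2, hed⟩
  let A : Finset Q := Finset.univ.filter fun q => ∃ d, R d ≠ 0 ∧ (κ (s d) = q ∨ κ (t d) = q)
  have hpath : Relation.ReflTransGen
      (fun c d' => c ∈ A ∧ d' ∈ A ∧ ClassAdj s t κ {e | R e ≠ 0 ∧ e ≠ d} c d') c a := by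
    refine reflTransGen_imp ?_ (reflTransGen_of_conn (κ := id) (C := ∅) (by simp) hconn)
    rintro x y ⟨e, ⟨he, -⟩, h1⟩
    simp only [A, Finset.mem_filter, Finset.mem_univ, true_and]
    refine ⟨⟨e, he.1, h1.imp (fun h => h.1) fun h => h.1⟩, ⟨e, he.1, ?_⟩, e, he, h1⟩
    exact (h1.imp (fun h => h.2) fun h => h.2).symm
  obtain ⟨w, ε, g, hw, hg1, hg2, hg3⟩ := h.exists_lift (fun e he => hRC e he.1) _ A rfl hpath hu
    (0 + p d)
  set F : E → ℤ := fun e => (if e = d then k else 0) + g e with hF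
  have hFb : ∀ x, bd s t p F x = (if r = x then 1 else 0) - sgn ε * (if w = x then 1 else 0) := by
    intro x
    rw [hF, bd_add, hkb, hg1, sgn_zero]
    ring
  have hgd : g d = 0 := (hg3 d hdC).resolve_right fun h1 => h1.2.1.2 rfl
  have hFR : ∀ e ∉ C, R e = 0 → F e = 0 := by
    intro e he hRe
    have h1 : e ≠ d := by rintro rfl; exact hd hRe
    simp only [hF, if_neg h1, zero_add]
    exact (hg3 e he).resolve_right fun h2 => h2.2.1.1 hRe
  have hF1 : ∀ e ∉ C, F e = 0 ∨ F e = 1 ∨ F e = -1 := by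
    intro e he
    by_cases hed : e = d
    · subst hed
      simp only [hF, if_true, hgd, add_zero]
      exact Or.inr hk
    · simp only [hF, if_neg hed, zero_add]
      exact (hg3 e he).imp_right fun h1 => h1.1
  let x : E → ZMod 2 := fun e => if e ∈ C then 0 else (F e : ZMod 2)
  have hxR : ∀ e, x e ≠ 0 → R e ≠ 0 := by
    intro e he hRe
    by_cases heC : e ∈ C
    · simp [x, heC] at he
    · simp [x, heC, hFR e heC hRe] at he
  have hxb : ∀ q, bdTwo (κ ∘ s) (κ ∘ t) x q = 0 := by
    intro q
    have h1 : bdTwo (κ ∘ s) (κ ∘ t) x q = bdTwo (κ ∘ s) (κ ∘ t) (fun e => (F e : ZMod 2)) q := by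
      refine Finset.sum_congr rfl fun e _ => ?_
      by_cases heC : e ∈ C
      · simp only [Function.comp, h.map_eq heC, CharTwo.add_self_eq_zero, mul_zero]
      · simp only [x, if_neg heC]
    rw [h1, bdTwo_comp]
    simp only [← bd_cast s t p, hFb]
    push_cast
    simp only [sgn_cast, CharTwo.sub_eq_add, mul_add, Finset.sum_add_distrib, mul_ite,
      mul_one, mul_zero, Finset.sum_ite_eq, Finset.mem_univ, if_true, hr, hw,
      CharTwo.add_self_eq_zero]
  have hxd : x d ≠ 0 := by
    simp only [x, if_neg hdC, hF, if_true, hgd, add_zero]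
    rcases hk with hk | hk <;> rw [hk] <;> decide
  -- The lifted closed path projects to a nonzero cycle `x` inside `R`. If `x` were even, `x + R`
  -- would be odd and inside `R`, hence equal to `R`, forcing `x = 0`.
  have hxeq : x = R := by
    rcases zmod_cases (par p x) with h1 | h1
    · have h2 := hmin (fun e => x e + R e) (fun e he hRe => ?_) (fun q => ?_) ?_
      · have h3 := congrFun h2 d
        exact absurd (add_eq_right.1 h3) hxd
      · refine he ?_
        by_contra h3
        exact hxR e (fun h4 => h3 (by rw [h4, hRe, add_zero])) hRe
      · rw [bdTwo_add, hxb, hR, add_zero]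
      · rw [par_add, h1, hodd, zero_add]
    · exact hmin x hxR hxb h1
  refine ⟨r, w, ε, F, hr, hw, hFb, fun e he => ?_, fun e he => ⟨fun hRe => ?_, hFR e he⟩⟩
  · have hed : e ≠ d := by rintro rfl; exact hdC he
    simp only [hF, if_neg hed, zero_add]
    refine (hg2 e he).imp_right fun h1 => ⟨h1.1, h1.2.2, ?_⟩
    simpa [A] using h1.2.1
  · refine (hF1 e he).resolve_left fun h0 => hRe ?_
    rw [← hxeq]
    simp [x, he, h0]

/-- A minimal odd cycle of the graph of classes together with a path to a prescribed class. -/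
lemma IsBalanced.exists_lollipop (h : IsBalanced s t p C κ o) {R : E → ZMod 2}
    (hRC : ∀ e, R e ≠ 0 → e ∉ C) (hR : ∀ q, bdTwo (κ ∘ s) (κ ∘ t) R q = 0) (hodd : par p R = 1)
    (hmin : ∀ x : E → ZMod 2, (∀ e, x e ≠ 0 → R e ≠ 0) →
      (∀ q, bdTwo (κ ∘ s) (κ ∘ t) x q = 0) → par p x = 1 → x = R)
    {z v : V} {d : E} (hd : R d ≠ 0)
    (hz : conn s t {e | R e = 0} z (s d) ∨ conn s t {e | R e = 0} z (t d))
    (hv : conn s t {e | R e = 0} z v) :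
    ∃ (r : V) (ε : ZMod 2), conn s t {e | R e = 0} z r ∧ ∀ w, κ w = κ v → ∃ g : E → ℤ,
      (∀ x, bd s t p g x = (if r = x then 1 else 0) - sgn ε * (if w = x then 1 else 0)) ∧
      (∀ e ∈ C, g e = 0 ∨ g e = o e) ∧
      ∀ e ∉ C, (R e ≠ 0 → g e = 1 ∨ g e = -1) ∧ (R e = 0 → g e = 0 ∨ g e = 1 ∨ g e = -1) := by
  classical
  have hCR : C ⊆ {e | R e = 0} := fun e he => by
    by_contra h1
    exact hRC e h1 he
  let P : Q → Prop := fun q => ∃ d, R d ≠ 0 ∧ (κ (s d) = q ∨ κ (t d) = q)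
  obtain ⟨y, hy, hyz⟩ : ∃ y, P (κ y) ∧ conn s t {e | R e = 0} z y := by
    rcases hz with hz | hz
    · exact ⟨_, ⟨d, hd, Or.inl rfl⟩, hz⟩
    · exact ⟨_, ⟨d, hd, Or.inr rfl⟩, hz⟩
  -- The tail starts at the last class that meets `R`, so it shares only the class `a` with the
  -- loop.
  obtain ⟨a, ⟨d, hd, ha⟩, hya, hva, hav⟩ := reflTransGen_last hy (reflTransGen_of_conn (C := C)
    (fun e he => h.map_eq he) (Setoid.trans' _ (Setoid.symm' _ hyz) hv))
  obtain ⟨r, w₁, ε₁, g₁, hr, hw₁, hg₁, hg₁C, hg₁B⟩ := h.exists_loop hRC hR hodd hmin hd ha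
  let A : Finset Q := Finset.univ.filter fun q => q = a ∨ ¬ P q
  obtain ⟨w₂, ε, g₂, hw₂, hg₂, hg₂C, hg₂B⟩ := h.exists_lift (S := {e | R e = 0} \ C) (fun e he => he.2)
    _ A rfl (a := a) (b := κ v) (reflTransGen_imp (fun c d hcd => by
      simpa only [A, Finset.mem_filter, Finset.mem_univ, true_and] using hcd) hav) hw₁ ε₁
  refine ⟨r, ε, Setoid.trans' _ hyz (h.conn_of_reflTransGen hCR (reflTransGen_imp ?_ hya) hr),
    fun w hw => ?_⟩
  · rintro c d ⟨e, he, h1⟩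
    exact ⟨e, he.1, h1⟩
  obtain ⟨g₃, hg₃C, hg₃⟩ := h.exists_signed_path ε (hw₂.trans hw.symm)
  -- The loop avoids edges of `C` in class `a`, the tail those in its last class, and `g₃` stays in
  -- the latter. The three pieces use disjoint parts of `C`, so no edge of `C` is used twice.
  refine ⟨fun e => (g₁ e + g₂ e) + g₃ e, fun x => ?_, fun e he => ?_, fun e he => ?_⟩
  · rw [bd_add, bd_add, hg₁, hg₂, hg₃]
    ring
  · beta_reduce
    have h1 := hg₁C e he
    have h2 : g₂ e = 0 ∨ (g₂ e = o e ∧ (κ (s e) = a ∨ ¬ P (κ (s e))) ∧ κ (s e) ≠ κ v) := by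
      simpa only [A, Finset.mem_filter, Finset.mem_univ, true_and] using hg₂C e he
    have h3 : g₃ e = 0 ∨ (g₃ e = o e ∧ κ (s e) = κ v) :=
      (hg₃C e).imp_right fun h => ⟨h.1, h.2.2.trans hw₂⟩
    rcases h1 with h1 | ⟨h1, h1a, h1P⟩
    · rcases h2 with h2 | ⟨h2, -, h2v⟩
      · rcases h3 with h3 | ⟨h3, -⟩
        · left; omega
        · right; omega
      · rcases h3 with h3 | ⟨-, h3⟩
        · right; omega
        · exact absurd h3 h2v
    · rcases h2 with h2 | ⟨-, h2 | h2, -⟩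
      · rcases h3 with h3 | ⟨-, h3⟩
        · right; omega
        · rcases hva with h4 | h4
          · exact absurd (h3.trans h4) h1a
          · exact absurd (h3 ▸ h1P) h4
      · exact absurd h2 h1a
      · exact absurd h1P h2
  · beta_reduce
    have h3 : g₃ e = 0 := (hg₃C e).resolve_right fun h1 => he h1.2.1
    have h2 := hg₂B e he
    obtain ⟨h1, h1'⟩ := hg₁B e he
    refine ⟨fun hRe => ?_, fun hRe => ?_⟩
    · have h4 : g₂ e = 0 := h2.resolve_right fun h5 => hRe h5.2.1.1
      have := h1 hRe
      omega
    · have := h1' hRe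
      rcases h2 with h2 | ⟨h2, -⟩ <;> omega

end Lollipop

end SignedFlow

/-! ### Assembling the flow in the odd case. -/

namespace SignedFlow

set_option linter.unusedSectionVars false

section Broken

variable {V E : Type*} [DecidableEq V] [Fintype E] [DecidableEq E] {s t : E → V}

/-- A flow on all components, except that on the component of `z` it is broken at two places of the
closed walk. -/
theorem exists_broken_flow (p : E → ZMod 2) {m : E → ℕ}
    (hm : ∀ v, bdTwo s t (fun e => (m e : ZMod 2)) v = 0)
    (hpar : ∀ z, ∀ x : E → ZMod 2, (∀ e, conn s t {e | m e ≠ 0} z (s e) → x e = m e) →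
      (∀ e, ¬ conn s t {e | m e ≠ 0} z (s e) → x e = 0) → par p x = 0) (z : V) :
    ∃ T : V → ZMod 2 → Prop,
      (∀ v, conn s t {e | m e ≠ 0} z v → ∃ a, T v a) ∧
      (∀ e, m e ≠ 0 → conn s t {e | m e ≠ 0} z (s e) → ∃ a, T (s e) a ∧ T (t e) (a + p e)) ∧
      ∀ u a w b, T u a → T w b → ∃ g : E → ℤ,
        (∀ e, |g e| ≤ m e ∧ (g e : ZMod 2) = m e) ∧
        ∀ v, bd s t p g v = 2 * (sgn a * (if u = v then 1 else 0)
          - sgn b * (if w = v then 1 else 0)) := by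
  classical
  obtain ⟨T, h1, h2, h3⟩ := exists_tour p hm z
  obtain ⟨g₀, hg₀, hb₀⟩ := exists_flow_of_even p hm hpar
  refine ⟨T, h1, h2, fun u a w b hu hw => ?_⟩
  obtain ⟨g, hg1, hg2, hg3⟩ := h3 (hpar z) u a w b hu hw
  have hr := bd_restrict (s := s) (t := t) (p := p) (fun v => conn s t {e | m e ≠ 0} z v)
    (f := g₀) fun e he => conn_iff_of_mem (S := {e | m e ≠ 0}) (fun h0 => he (by
      have := (hg₀ e).1
      rw [h0] at this
      simpa using this)) z
  refine ⟨fun e => g e + (g₀ e + (-1) * if conn s t {e | m e ≠ 0} z (s e) then g₀ e else 0),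
    fun e => ?_, fun v => ?_⟩
  · by_cases he : conn s t {e | m e ≠ 0} z (s e)
    · simp only [if_pos he, neg_one_mul, add_neg_cancel, add_zero]
      exact hg1 e he
    · simp only [if_neg he, mul_zero, add_zero, hg2 e he, zero_add]
      exact hg₀ e
  · rw [bd_add, bd_add, bd_smul, hr, hb₀, hg3]
    simp

end Broken

section Odd

variable {V Q E : Type*} [Fintype V] [DecidableEq V] [Fintype Q] [DecidableEq Q] [Fintype E]
  [DecidableEq E] {s t : E → V} {p : E → ZMod 2} {C : Set E} {κ : V → Q} {o : E → ℤ}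

/-- The flow that is obtained from a minimal odd cycle of the graph of classes. -/
theorem IsBalanced.hasNZFlow (h : IsBalanced s t p C κ o) (hconn : ∀ a b, conn s t Set.univ a b)
    (heven : ∀ q, bdTwo (κ ∘ s) (κ ∘ t) (fun _ => 1) q = 0) {R : E → ZMod 2}
    (hRC : ∀ e, R e ≠ 0 → e ∉ C) (hR : ∀ q, bdTwo (κ ∘ s) (κ ∘ t) R q = 0) (hodd : par p R = 1)
    (hmin : ∀ x : E → ZMod 2, (∀ e, x e ≠ 0 → R e ≠ 0) →
      (∀ q, bdTwo (κ ∘ s) (κ ∘ t) x q = 0) → par p x = 1 → x = R)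
    (hpar : ∀ z, ∀ x : E → ZMod 2,
      (∀ e ∉ C, R e = 0 → conn s t {e | R e = 0} z (s e) → x e = 1) →
      (∀ e ∉ C, ¬ (R e = 0 ∧ conn s t {e | R e = 0} z (s e)) → x e = 0) → par p x = 0)
    {z : V} {y : E → ZMod 2} (hy : ∀ e, y e ≠ 0 → R e = 0 ∧ conn s t {e | R e = 0} z (s e))
    (hyb : ∀ q, bdTwo (κ ∘ s) (κ ∘ t) y q = 0) (hyp : par p y = 1) : HasNZFlow s t p 8 := by
  classical
  have : Nonempty V := ⟨z⟩
  let x₀ : E → ZMod 2 := fun e => if e ∈ C then 0 else 1 + R e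
  have hx₀ : ∀ q, bdTwo (κ ∘ s) (κ ∘ t) x₀ q = 0 := by
    intro q
    have h1 : bdTwo (κ ∘ s) (κ ∘ t) x₀ q = bdTwo (κ ∘ s) (κ ∘ t) (fun e => 1 + R e) q := by
      refine Finset.sum_congr rfl fun e _ => ?_
      by_cases heC : e ∈ C
      · simp only [Function.comp, h.map_eq heC, CharTwo.add_self_eq_zero, mul_zero]
      · simp only [x₀, if_neg heC]
    rw [h1, bdTwo_add, heven, hR, add_zero]
  -- Edges of `C` are chosen to repair the degree parities of `x₀` inside each class. This is
  -- possible because `x₀` is a cycle after contraction.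
  obtain ⟨P, hPC, hP⟩ := exists_bdTwo_eq s t C (bdTwo s t x₀) (Function.invFun κ ∘ κ)
    (fun v => (h.eq_iff _ _).1 (Function.invFun_eq ⟨v, rfl⟩)) fun w => by
      have h1 := bdTwo_comp (Function.invFun κ ∘ κ) s t x₀ w
      have h2 := bdTwo_comp (Function.invFun κ) (κ ∘ s) (κ ∘ t) x₀ w
      simp only [hx₀, mul_zero, Finset.sum_const_zero] at h2
      simp only [ite_mul, one_mul, zero_mul] at h1
      exact h1.symm.trans h2
  let m : E → ℕ := fun e => if e ∈ C then (if P e = 0 then 2 else 1) else if R e = 0 then 1 else 0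
  have hmcast : ∀ e, (m e : ZMod 2) = P e + x₀ e := by
    intro e
    by_cases heC : e ∈ C
    · simp only [m, x₀, if_pos heC, add_zero]
      rcases zmod_cases (P e) with h1 | h1 <;> rw [h1] <;> rfl
    · have h0 : P e = 0 := by by_contra h0; exact heC (hPC e h0)
      simp only [m, x₀, if_neg heC, h0, zero_add]
      rcases zmod_cases (R e) with h1 | h1 <;> rw [h1] <;> rfl
  have hm : ∀ v, bdTwo s t (fun e => (m e : ZMod 2)) v = 0 := by
    intro v
    simp only [hmcast]
    rw [bdTwo_add, hP, CharTwo.add_self_eq_zero]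
  have hset : {e | m e ≠ 0} = {e | R e = 0} := by
    ext e
    by_cases heC : e ∈ C
    · have h1 : R e = 0 := by by_contra h1; exact hRC e h1 heC
      simp only [m, if_pos heC, Set.mem_ofPred_eq, h1, iff_true]
      split_ifs <;> decide
    · by_cases h1 : R e = 0 <;> simp [m, heC, h1]
  obtain ⟨T, hT1, hT2, hT3⟩ := exists_broken_flow p hm (by
    rw [hset]
    refine fun z x hx1 hx2 => hpar z x (fun e heC hRe hz => ?_) fun e heC he => ?_
    · rw [hx1 e hz]
      simp [m, heC, hRe]
    · by_cases hz : conn s t {e | R e = 0} z (s e)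
      · rw [hx1 e hz]
        simp [m, heC, show R e ≠ 0 from fun h0 => he ⟨h0, hz⟩]
      · exact hx2 e hz) z
  rw [hset] at hT1 hT2
  -- If no class were visited with both parities, the parity of the visits would be a potential on
  -- the classes in the component of `z`, contradicting its odd cycle `y`.
  obtain ⟨u₀, u₁, hu, hκ, hu₀, hu₁⟩ : ∃ u₀ u₁, conn s t {e | R e = 0} z u₀ ∧ κ u₁ = κ u₀ ∧
      T u₀ 0 ∧ T u₁ 1 := by
    by_contra! hno
    let c : Q → ZMod 2 := fun q => if ∃ u, κ u = q ∧ T u 1 then 1 else 0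
    have hc : ∀ u a, conn s t {e | R e = 0} z u → T u a → c (κ u) = a := by
      intro u a hzu hua
      rcases zmod_cases a with rfl | rfl
      · exact if_neg fun ⟨u₁, h1, h2⟩ => hno u u₁ hzu h1 hua h2
      · exact if_pos ⟨u, rfl, hua⟩
    have h1 := sum_mul_bdTwo (κ ∘ s) (κ ∘ t) y c
    simp only [hyb, mul_zero, Finset.sum_const_zero] at h1
    have h2 : par p y = 0 := by
      refine Eq.trans (Finset.sum_congr rfl fun e _ => ?_) h1.symm
      by_cases hye : y e = 0
      · rw [hye, zero_mul, zero_mul]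
      · obtain ⟨hRe, hze⟩ := hy e hye
        have hme : m e ≠ 0 := by
          have : e ∈ {e | m e ≠ 0} := hset ▸ hRe
          exact this
        obtain ⟨a, ha1, ha2⟩ := hT2 e hme hze
        simp only [Function.comp]
        rw [hc _ _ hze ha1, hc _ _ ((conn_iff_of_mem (S := {e | R e = 0}) hRe z).1 hze) ha2,
          ← add_assoc, CharTwo.add_self_eq_zero, zero_add]
    rw [h2] at hyp
    exact zero_ne_one hyp
  obtain ⟨d, hd, hzd⟩ : ∃ d, R d ≠ 0 ∧
      (conn s t {e | R e = 0} z (s d) ∨ conn s t {e | R e = 0} z (t d)) := by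
    by_contra! hno
    obtain ⟨d, hd⟩ : ∃ d, R d ≠ 0 := by
      by_contra! h0
      simp [par, h0] at hodd
    have h1 := conn_const (c := fun v => conn s t {e | R e = 0} z v) (fun e _ => propext (by
      by_cases hRe : R e = 0
      · exact conn_iff_of_mem (S := {e | R e = 0}) hRe z
      · exact ⟨fun h1 => absurd h1 (hno e hRe).1, fun h1 => absurd h1 (hno e hRe).2⟩)) (hconn z (s d))
    exact (hno d hd).1 (h1 ▸ Setoid.refl' _ z)
  obtain ⟨r, ε, hzr, hg⟩ := h.exists_lollipop hRC hR hodd hmin hd hzd hu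
  obtain ⟨a, ha⟩ := hT1 r hzr
  -- The lollipop reaches every vertex of this class with the same sign, so the end can be one
  -- visited by the tour with the matching parity.
  obtain ⟨w, hw, hTw⟩ : ∃ w, κ w = κ u₀ ∧ T w (a + ε) := by
    rcases zmod_cases (a + ε) with h1 | h1 <;> rw [h1]
    · exact ⟨u₀, rfl, hu₀⟩
    · exact ⟨u₁, hκ, hu₁⟩
  obtain ⟨g, hgb, hgC, hgB⟩ := hg w hw
  obtain ⟨f, hf, hfb⟩ := hT3 r a w (a + ε) ha hTw
  -- The factor `-sgn a` normalises the break of `f` at `r`, so that the boundary of `2g` cancels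
  -- both breaks.
  refine ⟨fun e => (3 * o e + (-sgn a) * f e) + 2 * g e, fun v => ?_, fun e => ?_⟩
  · rw [bd_add, bd_add, bd_smul, bd_smul, bd_smul, h.bd_eq, hfb, hgb, sgn_add]
    linear_combination (-2 * (if r = v then 1 else 0) + 2 * sgn ε * (if w = v then 1 else 0)) *
      sgn_mul_self a
  · beta_reduce
    obtain ⟨hf1, hf2⟩ := hf e
    have hf' : |(-sgn a) * f e| ≤ m e := by
      rw [abs_mul]
      rcases sgn_cases a with h1 | h1 <;> simpa [h1] using hf1
    have hf3 : (((-sgn a) * f e : ℤ) : ZMod 2) = m e := by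
      push_cast
      rw [sgn_cast, neg_one_mul, CharTwo.neg_eq, hf2]
    generalize (-sgn a) * f e = k at hf' hf3 ⊢
    rw [abs_le] at hf'
    by_cases heC : e ∈ C
    · have hm2 : m e ≤ 2 := by simp only [m, if_pos heC]; split_ifs <;> decide
      have h1 := h.value e heC
      have h2 := hgC e heC
      rw [abs_lt]
      omega
    · have h0 := h.eq_zero e heC
      obtain ⟨h1, h2⟩ := hgB e heC
      rw [abs_lt]
      by_cases hRe : R e = 0
      · have h3 := h2 hRe
        have hm1 : m e = 1 := by simp [m, heC, hRe]
        rw [hm1] at hf3 hf'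
        have hodd : ¬ (2 : ℤ) ∣ k := by
          rw [← even_iff_cast, hf3]
          decide
        push_cast at hf'
        omega
      · have h3 := h1 hRe
        have hm0 : m e = 0 := by simp [m, heC, hRe]
        rw [hm0] at hf'
        push_cast at hf'
        omega

end Odd

end SignedFlow

/-! ### Connected signed graphs. -/

namespace SignedFlow

set_option linter.unusedSectionVars false

section Connected

variable {V E : Type*} [Fintype V] [DecidableEq V] [Fintype E] [DecidableEq E] {s t : E → V}
  {p : E → ZMod 2}

lemma sum_subtype_of_eq_zero {M : Type*} [AddCommMonoid M] (P : E → Prop) [DecidablePred P]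
    {f : E → M} (hf : ∀ e, ¬ P e → f e = 0) : ∑ e, f e = ∑ e : {e // P e}, f e.1 := by
  rw [← Fintype.sum_subtype_add_sum_subtype P f, Fintype.sum_eq_zero (fun e : {e // ¬ P e} => f e.1)
    fun e => hf _ e.2, add_zero]

/-- A connected flow-admissible signed multigraph that is covered by two cycles, the first of which
is positive while the second has an odd number of negative edges, has a nowhere-zero `8`-flow. -/
theorem hasNZFlow_of_odd_cover {x₁ x₂ : E → ZMod 2} {k : ℤ} (hconn : ∀ a b, conn s t Set.univ a b)
    (h₁ : ∀ v, bdTwo s t x₁ v = 0) (h₂ : ∀ v, bdTwo s t x₂ v = 0) (hp₁ : ∀ e, x₁ e ≠ 0 → p e = 0)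
    (hp₂ : par p x₂ = 1) (hcov : ∀ e, x₁ e = 0 → x₂ e ≠ 0) (hF : HasNZFlow s t p k) :
    HasNZFlow s t p 8 := by
  classical
  let C : Set E := {e | x₁ e ≠ 0}
  have hC : ∀ e, e ∉ C ↔ x₁ e = 0 := fun e => not_not
  obtain ⟨o, ho1, ho2, ho3⟩ := exists_flow_of_pos p h₁ hp₁
  let κ : V → Quotient (conn s t C) := Quotient.mk _
  have hκ : ∀ a b, κ a = κ b ↔ conn s t C a b := fun a b => Quotient.eq
  have h : IsBalanced s t p C κ o := ⟨hκ, ho1, fun e he => ho2 e ((hC e).1 he), hp₁, ho3⟩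
  let i : {e : E // x₁ e = 0} → E := Subtype.val
  have hbd : ∀ (x : E → ZMod 2) q,
      bdTwo (κ ∘ s) (κ ∘ t) x q = bdTwo (κ ∘ s ∘ i) (κ ∘ t ∘ i) (x ∘ i) q := fun x q =>
    sum_subtype_of_eq_zero (fun e => x₁ e = 0) fun e he => by
      simp only [Function.comp, h.map_eq he, CharTwo.add_self_eq_zero, mul_zero]
  have hpar : ∀ x : E → ZMod 2, par p x = par (p ∘ i) (x ∘ i) := fun x =>
    sum_subtype_of_eq_zero (fun e => x₁ e = 0) fun e he => by rw [hp₁ e he, mul_zero]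
  have hx₂ : x₂ ∘ i = fun _ => 1 := by
    ext e
    exact zmod_ne_zero.1 (hcov e.1 e.2)
  have heven : ∀ q, bdTwo (κ ∘ s ∘ i) (κ ∘ t ∘ i) (fun _ => 1) q = 0 := by
    intro q
    rw [← hx₂, ← hbd, bdTwo_comp]
    simp [h₂]
  have hodd : par (p ∘ i) (fun _ => 1) = 1 := by rw [← hx₂, ← hpar, hp₂]
  have hsing : NoSingleton (κ ∘ s ∘ i) (κ ∘ t ∘ i) (p ∘ i) := by
    intro c e₀ hc
    obtain ⟨F, hF1, hF2⟩ := hF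
    -- After switching by `c ∘ κ`, all edges but `e₀` are positive and cancel; the remaining term is
    -- `2 F e₀` up to sign, so `F e₀` would vanish.
    have h3 := sum_mul_bd s t p F fun v => sgn (c (κ v))
    simp only [hF1, mul_zero, Finset.sum_const_zero] at h3
    have hc' : ∀ e, x₁ e = 0 → p e + (c (κ (s e)) + c (κ (t e))) = if e = e₀.1 then 1 else 0 := by
      intro e he
      simpa [i, Subtype.ext_iff] using hc ⟨e, he⟩
    rw [Finset.sum_eq_single e₀.1] at h3
    · have h4 := hc' e₀.1 e₀.2
      rw [if_pos rfl] at h4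
      have h5 : p e₀.1 + c (κ (t e₀.1)) = 1 + c (κ (s e₀.1)) := by
        linear_combination h4 - CharTwo.add_self_eq_zero (c (κ (s e₀.1)))
      rw [← sgn_add, h5, sgn_add, show sgn 1 = -1 from rfl] at h3
      have h6 : F e₀.1 * (2 * sgn (c (κ (s e₀.1)))) = 0 := by rw [h3]; ring
      exact (mul_ne_zero (hF2 _).1 (mul_ne_zero two_ne_zero (sgn_ne_zero _))) h6
    · intro e _ he
      rw [← sgn_add]
      by_cases heC : x₁ e = 0
      · have h4 := hc' e heC
        rw [if_neg he] at h4
        have h5 : p e + c (κ (t e)) = c (κ (s e)) := by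
          linear_combination h4 - CharTwo.add_self_eq_zero (c (κ (s e)))
        rw [h5, sub_self, mul_zero]
      · rw [hp₁ e heC, h.map_eq heC, zero_add, sub_self, mul_zero]
    · simp
  have hmap : ∀ {S : Set E} {a b}, conn s t S a b →
      conn (κ ∘ s ∘ i) (κ ∘ t ∘ i) (i ⁻¹' S) (κ a) (κ b) := by
    intro S a b hab
    refine conn_le (T := Setoid.comap κ (conn (κ ∘ s ∘ i) (κ ∘ t ∘ i) (i ⁻¹' S))) (fun e he => ?_) hab
    show conn (κ ∘ s ∘ i) (κ ∘ t ∘ i) (i ⁻¹' S) (κ (s e)) (κ (t e))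
    by_cases heC : x₁ e = 0
    · exact conn_edge (s := κ ∘ s ∘ i) (t := κ ∘ t ∘ i) (e := ⟨e, heC⟩) he
    · rw [h.map_eq heC]
  obtain ⟨R', z', hRz, hmin, heven'⟩ := exists_isOddPair_minimal (fun a b => by
    obtain ⟨a, rfl⟩ := Quotient.exists_rep a
    obtain ⟨b, rfl⟩ := Quotient.exists_rep b
    exact hmap (hconn a b)) heven hodd (hasDisjointOddCycles _ rfl heven hodd hsing)
  obtain ⟨z, rfl⟩ := Quotient.exists_rep z'
  let ext : ({e : E // x₁ e = 0} → ZMod 2) → E → ZMod 2 := fun x e => if h : x₁ e = 0 then x ⟨e, h⟩ else 0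
  have hext : ∀ x, ext x ∘ i = x := by
    intro x
    ext e
    simp [ext, i, e.2]
  have hexti : ∀ x e, ext x e.1 = x e := fun x e => congrFun (hext x) e
  have hext0 : ∀ x e, ext x e ≠ 0 → x₁ e = 0 := by
    intro x e he
    by_contra h1
    simp [ext, h1] at he
  have hpre : i ⁻¹' {e | ext R' e = 0} = {e | R' e = 0} := by
    ext e
    show (ext R' ∘ i) e = 0 ↔ _
    rw [hext]
    rfl
  have hiff : ∀ a b, conn s t {e | ext R' e = 0} a b ↔
      conn (κ ∘ s ∘ i) (κ ∘ t ∘ i) {e | R' e = 0} (κ a) (κ b) := by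
    intro a b
    refine ⟨fun hab => hpre ▸ hmap hab, fun hab => ?_⟩
    refine h.conn_of_reflTransGen (S := {e | ext R' e = 0}) (fun e he => ?_) (reflTransGen_imp ?_
      (reflTransGen_of_conn (κ := id) (C := ∅) (by simp) hab)) rfl
    · by_contra h1
      exact he (hext0 _ _ h1)
    · rintro c d ⟨e, ⟨he, -⟩, h1⟩
      refine ⟨e.1, ?_, h1⟩
      rw [← hpre] at he
      exact he
  obtain ⟨hR1, hR2, y, hy1, hy2, hy3⟩ := hRz
  refine h.hasNZFlow (R := ext R') (y := ext y) (z := z) hconn (fun q => ?_) (fun e he => ?_)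
    (fun q => ?_) ?_ (fun x hx1 hx2 hx3 => ?_) (fun w x hx1 hx2 => ?_) (fun e he => ?_)
    (fun q => ?_) ?_
  · rw [hbd]; exact heven q
  · exact (hC e).2 (hext0 _ _ he)
  · rw [hbd, hext, hR1]
  · rw [hpar, hext, hR2]
  · have h3 := hmin (x ∘ i) (fun e he => ?_) (fun q => by rw [← hbd, hx2]) (by rw [← hpar, hx3])
    · rw [← h3]
      ext e
      by_cases heC : x₁ e = 0
      · simp [ext, heC, i]
      · have h4 : x e = 0 := by
          by_contra h4
          exact heC (hext0 _ _ (hx1 e h4))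
        simp [ext, heC, h4]
    · rw [← hexti R']
      exact hx1 e.1 he
  · rw [hpar]
    refine heven' (κ w) _ (fun e he hz => ?_) fun e he => ?_
    · exact hx1 e.1 ((hC _).2 e.2) (by rw [hexti, he]) ((hiff _ _).2 hz)
    · refine hx2 e.1 ((hC _).2 e.2) fun h3 => he ⟨?_, (hiff _ _).1 h3.2⟩
      rw [← hexti R', h3.1]
  · have heC := hext0 _ _ he
    have h3 := hy1 ⟨e, heC⟩ (by rw [← hexti y]; exact he)
    exact ⟨(hexti R' ⟨e, heC⟩).trans h3.1, (hiff _ _).2 h3.2⟩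
  · rw [hbd, hext, hy2]
  · rw [hpar, hext, hy3]

/-- A connected flow-admissible signed multigraph has a nowhere-zero `8`-flow if the underlying graph
has a nowhere-zero `4`-flow. -/
theorem hasNZFlow_eight_of_connected {k : ℤ} (hconn : ∀ a b, conn s t Set.univ a b)
    (h4 : HasNZFlow s t (fun _ => 0) 4) (hF : HasNZFlow s t p k) : HasNZFlow s t p 8 := by
  obtain ⟨x₁, x₂, h₁, h₂, hcov⟩ := exists_cover_of_four_flow h4
  by_cases hgood : par p x₁ = 0 ∧ par p x₂ = 0
  · exact hasNZFlow_of_even_cover hconn h₁ h₂ hgood.1 hgood.2 hcov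
  obtain ⟨x₁, x₂, h₁, h₂, hp₁, hp₂, hcov⟩ : ∃ x₁ x₂ : E → ZMod 2, (∀ v, bdTwo s t x₁ v = 0) ∧
      (∀ v, bdTwo s t x₂ v = 0) ∧ par p x₁ = 0 ∧ par p x₂ = 1 ∧ ∀ e, x₁ e = 0 → x₂ e ≠ 0 := by
    rcases zmod_cases (par p x₁) with hp₁ | hp₁
    · exact ⟨x₁, x₂, h₁, h₂, hp₁, zmod_ne_zero.1 fun h => hgood ⟨hp₁, h⟩, hcov⟩
    rcases zmod_cases (par p x₂) with hp₂ | hp₂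
    · refine ⟨x₂, x₁, h₂, h₁, hp₂, hp₁, fun e he h0 => hcov e h0 he⟩
    -- If both cycles are odd, their sum is even and still covers every edge together with `x₂`.
    · refine ⟨fun e => x₁ e + x₂ e, x₂, fun v => by rw [bdTwo_add, h₁, h₂, add_zero], h₂, ?_, hp₂,
        fun e he h0 => ?_⟩
      · rw [par_add, hp₁, hp₂]; rfl
      · simp only [h0, add_zero] at he
        exact hcov e he h0
  by_cases hD : ∃ D : E → ZMod 2, (∀ e, D e ≠ 0 → x₁ e ≠ 0) ∧ (∀ v, bdTwo s t D v = 0) ∧ par p D = 1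
  · obtain ⟨D, hD1, hD2, hD3⟩ := hD
    refine hasNZFlow_of_even_cover hconn h₁ (x₂ := fun e => x₂ e + D e)
      (fun v => by rw [bdTwo_add, h₂, hD2, add_zero]) hp₁ (by rw [par_add, hp₂, hD3]; rfl)
      fun e he => ?_
    have h0 : D e = 0 := by
      by_contra h0
      exact hD1 e h0 he
    rw [h0, add_zero]
    exact hcov e he
  · obtain ⟨c, hc⟩ := exists_potential s t p {e | x₁ e ≠ 0} fun x hx1 hx2 =>
      (zmod_cases _).resolve_right fun h => hD ⟨x, hx1, hx2, h⟩
    have h8 := (hasNZFlow_of_odd_cover (p := fun e => p e + (c (s e) + c (t e))) hconn h₁ h₂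
      (fun e he => by rw [hc e he, CharTwo.add_self_eq_zero])
      (by rw [par_switch s t p x₂ h₂, hp₂]) hcov (hF.switch c)).switch c
    have hpp : (fun e => p e + (c (s e) + c (t e)) + (c (s e) + c (t e))) = p := by
      ext e
      rw [add_assoc, CharTwo.add_self_eq_zero, add_zero]
    rwa [hpp] at h8

end Connected

end SignedFlow

/-! ### Reduction to connected components. -/

namespace SignedFlow

section Components

variable {V E : Type*} [Fintype V] [DecidableEq V] [Fintype E] [DecidableEq E] {s t : E → V}
  {p : E → ZMod 2}

/-- The same without the assumption that the multigraph is connected. -/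
theorem hasNZFlow_eight {k : ℤ} (h4 : HasNZFlow s t (fun _ => 0) 4) (hF : HasNZFlow s t p k) :
    HasNZFlow s t p 8 := by
  classical
  let κ : V → Quotient (conn s t Set.univ) := Quotient.mk _
  have hκ : ∀ e, κ (s e) = κ (t e) := fun e => Quotient.sound (conn_edge (Set.mem_univ e))
  let s' : ∀ q, {e // κ (s e) = q} → {v // κ v = q} := fun q e => ⟨s e.1, e.2⟩
  let t' : ∀ q, {e // κ (s e) = q} → {v // κ v = q} := fun q e => ⟨t e.1, (hκ e.1).symm.trans e.2⟩
  have hbd : ∀ (p : E → ZMod 2) (f : E → ℤ) q (v : {v // κ v = q}),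
      bd s t p f v.1 = bd (s' q) (t' q) (fun e => p e.1) (fun e => f e.1) v := by
    intro p f q v
    refine (sum_subtype_of_eq_zero (fun e => κ (s e) = q) fun e he => ?_).trans
      (Finset.sum_congr rfl fun e _ => ?_)
    · rw [if_neg (by rintro h; exact he (h ▸ v.2)), if_neg (by rintro h; exact he (hκ e ▸ h ▸ v.2))]
      simp
    · simp only [s', t', Subtype.ext_iff]
  have hsub : ∀ {p : E → ZMod 2} {k : ℤ} q, HasNZFlow s t p k →
      HasNZFlow (s' q) (t' q) (fun e => p e.1) k := by
    rintro p k q ⟨f, hf1, hf2⟩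
    exact ⟨fun e => f e.1, fun v => by rw [← hbd, hf1], fun e => hf2 e.1⟩
  have hconn : ∀ q a b, conn (s' q) (t' q) Set.univ a b := by
    intro q a b
    have key : ∀ {v w : V}, conn s t Set.univ v w → ∀ (hv : κ v = q) (hw : κ w = q),
        conn (s' q) (t' q) Set.univ ⟨v, hv⟩ ⟨w, hw⟩ := by
      intro v w hvw
      induction hvw with
      | rel v w h =>
        obtain ⟨e, -, rfl, rfl⟩ := h
        exact fun hv _ => conn_edge (s := s' q) (t := t' q) (e := ⟨e, hv⟩) (Set.mem_univ _)
      | refl v => exact fun _ _ => Setoid.refl' _ _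
      | symm v w _ ih => exact fun hv hw => Setoid.symm' _ (ih hw hv)
      | trans u v w h1 _ ih1 ih2 =>
        intro hu hw
        have hv : κ v = q := (Quotient.sound h1).symm.trans hu
        exact Setoid.trans' _ (ih1 hu hv) (ih2 hv hw)
    exact key (Quotient.exact (a.2.trans b.2.symm)) a.2 b.2
  have h8 : ∀ q, HasNZFlow (s' q) (t' q) (fun e => p e.1) 8 := fun q =>
    hasNZFlow_eight_of_connected (hconn q) (hsub (p := fun _ => 0) q h4) (hsub q hF)
  choose f hf1 hf2 using h8
  refine ⟨fun e => f (κ (s e)) ⟨e, rfl⟩, fun v => ?_, fun e => hf2 _ _⟩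
  have hf3 : (fun e : {e // κ (s e) = κ v} => f (κ (s e.1)) ⟨e.1, rfl⟩) = f (κ v) := by
    funext ⟨e, he⟩
    have : ∀ q (h : κ (s e) = q), f (κ (s e)) ⟨e, rfl⟩ = f q ⟨e, h⟩ := by
      rintro q rfl
      rfl
    exact this _ he
  rw [hbd p _ (κ v) ⟨v, rfl⟩, hf3, hf1]

end Components

end SignedFlow

/-! ### Translation from half-edges to the standard orientation. -/

namespace SignedFlow

section Translation

variable {α β : Type*} (G : Graph α β)

/-- The vertex of the first half-edge. -/
noncomputable def firstEnd (e : E(G)) : V(G) := ⟨G.root (e, false), (G.isLink_root e).left_mem⟩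

/-- The vertex of the second half-edge. -/
noncomputable def secondEnd (e : E(G)) : V(G) := ⟨G.root (e, true), (G.isLink_root e).right_mem⟩

/-- The parity of a sign. -/
def unitPar (u : ℤˣ) : ZMod 2 := if u = 1 then 0 else 1

lemma sgn_unitPar (u : ℤˣ) : sgn (unitPar u) = u := by revert u; decide

variable {G} [Fintype E(G)]

/-- The sign of the first half-edge determines that of the second, so it can be absorbed into the
flow value; a loop contributes through both half-edges. -/
lemma sum_halfEdgesAt [DecidableEq V(G)] {σ : E(G) → ℤˣ} {τ : G.HalfEdge → ℤˣ}
    (hτ : G.IsOrientation σ τ) (f : E(G) → ℤ) (v : V(G)) :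
    ∑ h ∈ G.halfEdgesAt v.1, (τ h : ℤ) • f h.1 =
      bd (firstEnd G) (secondEnd G) (fun e => unitPar (σ e)) (fun e => τ (e, false) * f e) v := by
  classical
  rw [Graph.halfEdgesAt, Finset.sum_filter, Fintype.sum_prod_type]
  refine Finset.sum_congr rfl fun e _ => ?_
  have h1 : (τ (e, true) : ℤ) = -(σ e * τ (e, false)) := by
    have h2 : τ (e, true) = -(σ e * τ (e, false)) := by
      rw [← neg_mul, ← hτ e, mul_right_comm, Int.units_mul_self, one_mul]
    rw [h2]
    push_cast
    rfl
  rw [Fintype.sum_bool, sgn_unitPar]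
  simp only [firstEnd, secondEnd, Subtype.ext_iff, smul_eq_mul, h1]
  split_ifs <;> ring

lemma admitsSignedNZFlow_iff [DecidableEq V(G)] {σ : E(G) → ℤˣ} {k : ℕ} :
    G.AdmitsSignedNZFlow σ k ↔
      2 ≤ k ∧ HasNZFlow (firstEnd G) (secondEnd G) (fun e => unitPar (σ e)) k := by
  constructor
  · rintro ⟨τ, f, ⟨hk, ⟨hτ, hf⟩, hlt⟩, hne⟩
    refine ⟨hk, fun e => τ (e, false) * f e, fun v => ?_, fun e => ⟨?_, ?_⟩⟩
    · rw [← sum_halfEdgesAt hτ, hf v.1 v.2]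
    · exact mul_ne_zero (Units.ne_zero _) (hne e)
    · rw [abs_mul, Int.isUnit_iff_abs_eq.1 (Units.isUnit _), one_mul]
      exact hlt e
  · rintro ⟨hk, f, hf, hlt⟩
    have hτ : G.IsOrientation σ fun h => if h.2 then -σ h.1 else 1 := fun e => by simp
    refine ⟨_, f, ⟨hk, ⟨hτ, fun v hv => ?_⟩, fun e => (hlt e).2⟩, fun e => (hlt e).1⟩
    rw [sum_halfEdgesAt hτ f ⟨v, hv⟩, ← hf ⟨v, hv⟩]
    congr 1
    ext e
    simp

end Translation

end SignedFlow

theorem theorem1p2 {α β : Type*} (G : Graph α β) [Finite V(G)] [Fintype E(G)]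
    (σ : E(G) → ℤˣ) (hσ : G.FlowAdmissible σ) (hG : G.AdmitsNZFlow 4) :
    G.AdmitsSignedNZFlow σ 8 := by
  classical
  have := Fintype.ofFinite V(G)
  obtain ⟨k, -, hk⟩ := hσ
  exact SignedFlow.admitsSignedNZFlow_iff.2 ⟨by norm_num, SignedFlow.hasNZFlow_eight
    (SignedFlow.admitsSignedNZFlow_iff.1 hG).2 (SignedFlow.admitsSignedNZFlow_iff.1 hk).2⟩
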